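/- Setting. Let $\mathbb{R}^{4,2}$ be $\mathbb{R}^6$ with an inner product $(\cdot,\cdot)$ of signature $(++++--)$. Let $\mathfrak p$ with $(\mathfrak p,\mathfrak p)=-1$ and $\mathfrak q\perp\mathfrak p$ with $(\mathfrak q,\mathfrak q)>0$ be the point sphere complex and space form vector of a hyperbolic space form $\mathbb{Q}_{\mathfrak p,\mathfrak q}=\{x:(x,x)=0,(x,\mathfrak p)=0,(x,\mathfrak q)=-1\}$. Let $\mathfrak v,\mathfrak e_1,\mathfrak o,\mathfrak e_2$ be a pseudo-orthonormal basis of $\langle \mathfrak p,\mathfrak q\rangle^\perp$: $\mathfrak v,\mathfrak o$ are lightlike with $(\mathfrak v,\mathfrak o)=-1$, $\mathfrak e_1,\mathfrak e_2$ are unit spacelike, and all other products vanish. For $i=1,2$ let $\rho_i(\theta)$ be the parabolic rotation that fixes $\langle \mathfrak v,\mathfrak e_i\rangle^\perp$ pointwise and maps $\mathfrak e_i\mapsto \mathfrak e_i+\theta \mathfrak v$, $\mathfrak o\mapsto \mathfrak o+\theta \mathfrak e_i+\tfrac{\theta^2}{2}\mathfrak v$. Let $I$ be a non-empty open interval and let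 $\Lambda$ on $\mathbb{R}\times I\ni(\theta,t)$ be the (smooth) Legendre immersion of a surface in $\mathbb{Q}_{\mathfrak p,\mathfrak q}$, rotational with respect to $\rho_1$, i.e. spanned by two sphere congruences $\rho_1(\theta)c(t)$ with planar profile curves $c\perp \mathfrak e_1$. Assume that $(\Lambda,\mathfrak p^\pm)$ is linear Weingarten with real sphere complexes $\mathfrak p^\pm$, where $\langle \mathfrak p^+,\mathfrak p^-\rangle=\langle \mathfrak p,\mathfrak q\rangle$: $\Lambda$ is spanned by two real enveloped isothermic sphere congruences $s^\pm$ (each possessing a lift $\sigma$ with $\sigma_{uv}\parallel\sigma$ in suitable local coordinates) which separate the curvature sphere congruences of $\Lambda$ harmonically and satisfy $s^\pm\perp \mathfrak p^\pm$. Put $\kappa^\pm=(\mathfrak p^\pm,\mathfrak p^\pm)$, $\varepsilon=(\mathfrak p^+,\mathfrak p^-)$, $\Delta=\kappa^+\kappa^--\varepsilon^2$, and assume $\kappa^-\neq0$. Lifts $\mathfrak s^\pm$ of $s^\pm$ are Christoffel dual if $\mathfrak s^-_\theta=CU\,\mathfrak s^+_\theta/|\mathfrak s^+_\theta|^2$ and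 $\mathfrak s^-_t=-CV\,\mathfrak s^+_t/|\mathfrak s^+_t|^2$ for a constant $C\ne0$ and positive functions $U=U(\theta)$, $V=V(t)$ (where $|\mathfrak s^+_\theta|^2,|\mathfrak s^+_t|^2>0$). Proposition. Christoffel dual lifts $\mathfrak s^\pm$ of $s^\pm$ with $(\mathfrak s^\pm,\mathfrak p^\pm)=0$ and $(\mathfrak s^\pm,\mathfrak p^\mp)=\Delta$ exist. For any such lifts there is a constant $C\neq0$ with $\mathfrak s^-_\theta=C\,\mathfrak s^+_\theta/|\mathfrak s^+_\theta|^2$; for this $C$ the polynomial $$p_C(x)=\kappa^-x^2+2C\varepsilon x+\kappa^+C^2$$ has two real roots $C_1,C_2$ (counted with multiplicity); and, after a smooth regular reparametrization of the variable $t$ (possibly reversing its orientation) by an open interval, $$\mathfrak s^+(\theta,t)=\rho_1(\theta)\,\rho_2(\psi(t))\bigl(-\varepsilon\,\mathfrak p^++\kappa^+\mathfrak p^-+d(t)\,\mathfrak v+r(t)\,\mathfrak o\bigr)$$ with smooth functions $r,\psi,d$, where $r$ has no zeros, satisfying $$(r')^2=\frac{\kappa^-}{\Delta^2}(r^2-C_1)(r^2-C_2),\qquad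 \psi'=\sqrt{-\tfrac1\Delta}\;\frac{\varepsilon r^2+\kappa^+C}{r^2},\qquad d=\frac{\kappa^+\Delta}{2r}.$$ -/

import Mathlib

open Set
open scoped ContDiff

noncomputable section

/-- The underlying vector space of `ℝ^{4,2}`, in coordinates of an orthonormal basis. -/
abbrev R42 : Type := Fin 6 → ℝ

/-- The inner product of signature `(++++--)` on `ℝ^{4,2}`. -/
def lip (x y : R42) : ℝ :=
  -(x 0 * y 0) + x 1 * y 1 + x 2 * y 2 + x 3 * y 3 + x 4 * y 4 - x 5 * y 5

/-- The space form `Q_{p,q}`: lightlike `x` with `(x,p) = 0` and `(x,q) = -1`. -/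
def spaceForm (p q : R42) : Set R42 := {x | lip x x = 0 ∧ lip x p = 0 ∧ lip x q = -1}

/-- The oriented hyperplanes `T_{p,q}` of `Q_{p,q}`:
lightlike `x` with `(x,p) = -1` and `(x,q) = 0`. -/
def planeQuadric (p q : R42) : Set R42 := {x | lip x x = 0 ∧ lip x p = -1 ∧ lip x q = 0}

/-- `p` is a unit timelike point sphere complex and `q ⟂ p` is a space form vector such that
`Q_{p,q}` has negative curvature `κ = -(q,q)`. -/
structure IsHyperbolicSpaceForm (p q : R42) : Prop where
  pp : lip p p = -1
  pq : lip p q = 0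
  qq : 0 < lip q q

/-- A pseudo-orthonormal basis `v, e₁, o, e₂` of `⟨p,q⟩^⊥` with lightlike `v, o`,
`(v,o) = -1` and unit spacelike `e₁, e₂`. -/
structure IsParabolicFrame (p q v e₁ o e₂ : R42) : Prop where
  vv : lip v v = 0
  oo : lip o o = 0
  vo : lip v o = -1
  e₁e₁ : lip e₁ e₁ = 1
  e₂e₂ : lip e₂ e₂ = 1
  ve₁ : lip v e₁ = 0
  ve₂ : lip v e₂ = 0
  oe₁ : lip o e₁ = 0
  oe₂ : lip o e₂ = 0
  e₁e₂ : lip e₁ e₂ = 0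
  pv : lip p v = 0
  pe₁ : lip p e₁ = 0
  po : lip p o = 0
  pe₂ : lip p e₂ = 0
  qv : lip q v = 0
  qe₁ : lip q e₁ = 0
  qo : lip q o = 0
  qe₂ : lip q e₂ = 0

/-- The parabolic rotation with angle `θ` in the plane `⟨v,e⟩` (`v` lightlike, `e` unit spacelike,
`v ⟂ e`). It is the identity on `⟨v,e⟩^⊥` and, for lightlike `o ⟂ e` with `(v,o) = -1`, maps
`e ↦ e + θ v` and `o ↦ o + θ e + (θ²/2) v`. -/
def parRot (v e : R42) (θ : ℝ) (x : R42) : R42 :=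
  x - (θ * lip x v) • e + (θ * lip x e - θ ^ 2 / 2 * lip x v) • v

/-- Maps `(θ,t) ↦ s θ t` that are smooth on the parameter domain `Σ = ℝ × I`. -/
def SmoothOnStrip (I : Set ℝ) (s : ℝ → ℝ → R42) : Prop :=
  ContDiffOn ℝ ∞ (fun x : ℝ × ℝ => s x.1 x.2) (univ ×ˢ I)

/-- Partial derivative in the first variable. -/
def pdθ (s : ℝ → ℝ → R42) (θ t : ℝ) : R42 := deriv (fun θ' => s θ' t) θ

/-- Partial derivative in the second variable. -/
def pdt (s : ℝ → ℝ → R42) (θ t : ℝ) : R42 := deriv (fun t' => s θ t') t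

/-- `s` is a smooth lift of a sphere congruence `Σ → 𝓛`. -/
structure IsSphereCongruence (I : Set ℝ) (s : ℝ → ℝ → R42) : Prop where
  smooth : SmoothOnStrip I s
  ne_zero : ∀ θ, ∀ t ∈ I, s θ t ≠ 0
  null : ∀ θ, ∀ t ∈ I, lip (s θ t) (s θ t) = 0

/-- `s` and `σ` are lifts of the same sphere congruence. -/
def SameCongruence (I : Set ℝ) (s σ : ℝ → ℝ → R42) : Prop :=
  ∀ θ, ∀ t ∈ I, Submodule.span ℝ {s θ t} = Submodule.span ℝ {σ θ t}

/-- The sphere congruence with lift `s` is enveloped by `Λ`. -/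
def Envelopes (I : Set ℝ) (Λ : ℝ → ℝ → Submodule ℝ R42) (s : ℝ → ℝ → R42) : Prop :=
  ∀ θ, ∀ t ∈ I, s θ t ∈ Λ θ t

/-- The immersion condition: a tangent vector `X = a ∂_θ + b ∂_t` for which `ds(X) ∈ Λ` holds for
all sections `s` of `Λ` vanishes. -/
def ImmersionCondition (I : Set ℝ) (Λ : ℝ → ℝ → Submodule ℝ R42) : Prop :=
  ∀ θ, ∀ t ∈ I, ∀ a b : ℝ,
    (∀ s, SmoothOnStrip I s → Envelopes I Λ s → a • pdθ s θ t + b • pdt s θ t ∈ Λ θ t) →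
      a = 0 ∧ b = 0

/-- `Λ = ⟨f,n⟩` is the Legendre lift (satisfying the immersion condition) of the surface
`f : ℝ × I → Q_{p,q}` with tangent plane congruence `n : ℝ × I → T_{p,q}`. -/
structure IsLegendreLift (p q : R42) (I : Set ℝ) (f n : ℝ → ℝ → R42)
    (Λ : ℝ → ℝ → Submodule ℝ R42) : Prop where
  smooth_f : SmoothOnStrip I f
  smooth_n : SmoothOnStrip I n
  f_mem : ∀ θ, ∀ t ∈ I, f θ t ∈ spaceForm p q
  n_mem : ∀ θ, ∀ t ∈ I, n θ t ∈ planeQuadric p q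
  contact : ∀ θ, ∀ t ∈ I, lip (f θ t) (n θ t) = 0
  contact_θ : ∀ θ, ∀ t ∈ I, lip (pdθ f θ t) (n θ t) = 0
  contact_t : ∀ θ, ∀ t ∈ I, lip (pdt f θ t) (n θ t) = 0
  span_eq : ∀ θ, ∀ t ∈ I, Λ θ t = Submodule.span ℝ {f θ t, n θ t}
  immersion : ImmersionCondition I Λ

/-- `c` is a smooth lift of a planar profile curve `I → ⟨e⟩^⊥ ∩ 𝓛`. -/
structure IsProfileCurve (e : R42) (I : Set ℝ) (c : ℝ → R42) : Prop where
  smooth : ContDiffOn ℝ ∞ c I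
  ne_zero : ∀ t ∈ I, c t ≠ 0
  null : ∀ t ∈ I, lip (c t) (c t) = 0
  planar : ∀ t ∈ I, lip (c t) e = 0

/-- `Λ` is spanned by two sphere congruences that are rotational with respect to the parabolic
rotations in the plane `⟨v,e⟩`. -/
def IsParabolicRotational (v e : R42) (I : Set ℝ) (Λ : ℝ → ℝ → Submodule ℝ R42) : Prop :=
  ∃ c₁ c₂ : ℝ → R42, IsProfileCurve e I c₁ ∧ IsProfileCurve e I c₂ ∧
    ∀ θ, ∀ t ∈ I, Λ θ t = Submodule.span ℝ {parRot v e θ (c₁ t), parRot v e θ (c₂ t)}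

/-- `s` is (a lift of) a curvature sphere congruence of `Λ`: at every point its differential maps
some tangent direction into `Λ`. The condition does not depend on the lift. -/
def IsCurvatureSphere (I : Set ℝ) (Λ : ℝ → ℝ → Submodule ℝ R42) (s : ℝ → ℝ → R42) : Prop :=
  IsSphereCongruence I s ∧ Envelopes I Λ s ∧
    ∀ θ, ∀ t ∈ I, ∃ a b : ℝ, (a ≠ 0 ∨ b ≠ 0) ∧ a • pdθ s θ t + b • pdt s θ t ∈ Λ θ t

/-- The sphere congruence with lift `s` is isothermic: around every point of `ℝ × I` there are
coordinates `(u,v)`, with inverse chart `Φ : W → ℝ × I`, and a Moutard lift `σ`, that is, a lift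
with `σ_{uv}` parallel to `σ`. -/
def IsIsothermic (I : Set ℝ) (s : ℝ → ℝ → R42) : Prop :=
  IsSphereCongruence I s ∧
    ∀ θ, ∀ t ∈ I, ∃ (W : Set (ℝ × ℝ)) (Φ : ℝ × ℝ → ℝ × ℝ) (σ : ℝ → ℝ → R42),
      IsOpen W ∧ ContDiffOn ℝ ∞ Φ W ∧ InjOn Φ W ∧ (∀ w ∈ W, (fderiv ℝ Φ w).det ≠ 0) ∧
      (θ, t) ∈ Φ '' W ∧ Φ '' W ⊆ univ ×ˢ I ∧
      ContDiffOn ℝ ∞ (fun w : ℝ × ℝ => σ w.1 w.2) W ∧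
      ∀ w ∈ W,
        Submodule.span ℝ {σ w.1 w.2} = Submodule.span ℝ {s (Φ w).1 (Φ w).2} ∧
        pdt (pdθ σ) w.1 w.2 ∈ Submodule.span ℝ {σ w.1 w.2}

/-- The points `⟨x⟩, ⟨y⟩` of a projective line separate `⟨z⟩, ⟨w⟩` harmonically
(the cross ratio is `-1`). -/
def SeparatesHarmonically (x y z w : R42) : Prop :=
  LinearIndependent ℝ ![x, y] ∧ ∃ a b : ℝ, a ≠ 0 ∧ b ≠ 0 ∧
    Submodule.span ℝ {z} = Submodule.span ℝ {a • x + b • y} ∧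
    Submodule.span ℝ {w} = Submodule.span ℝ {a • x - b • y}

/-- `Λ` is an `Ω`-surface with the real pair of isothermic sphere congruences `⟨σp⟩, ⟨σm⟩`: they
are enveloped by (and span) `Λ` and separate its curvature sphere congruences harmonically. -/
structure IsOmegaSurface (I : Set ℝ) (Λ : ℝ → ℝ → Submodule ℝ R42)
    (σp σm : ℝ → ℝ → R42) : Prop where
  isothermic_p : IsIsothermic I σp
  isothermic_m : IsIsothermic I σm
  span_eq : ∀ θ, ∀ t ∈ I, Λ θ t = Submodule.span ℝ {σp θ t, σm θ t}
  harmonic : ∃ s₁ s₂ : ℝ → ℝ → R42, IsCurvatureSphere I Λ s₁ ∧ IsCurvatureSphere I Λ s₂ ∧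
    ∀ θ, ∀ t ∈ I, SeparatesHarmonically (σp θ t) (σm θ t) (s₁ θ t) (s₂ θ t)

/-- `(Λ, p^±)` is a linear Weingarten surface with real sphere complexes `pp = p⁺`, `pm = p⁻`: an
`Ω`-surface whose isothermic sphere congruences take values in the sphere complexes `p^±`. -/
structure IsLinearWeingarten (I : Set ℝ) (Λ : ℝ → ℝ → Submodule ℝ R42) (pp pm : R42)
    (σp σm : ℝ → ℝ → R42) : Prop where
  omega : IsOmegaSurface I Λ σp σm
  complex_p : ∀ θ, ∀ t ∈ I, lip (σp θ t) pp = 0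
  complex_m : ∀ θ, ∀ t ∈ I, lip (σm θ t) pm = 0

/-- `sp, sm` are Christoffel dual:
`s⁻_θ = C U s⁺_θ / |s⁺_θ|²` and `s⁻_t = -C V s⁺_t / |s⁺_t|²` with `U = U(θ)`, `V = V(t)`. -/
def IsChristoffelDual (I : Set ℝ) (sp sm : ℝ → ℝ → R42) : Prop :=
  ∃ (C : ℝ) (U V : ℝ → ℝ), C ≠ 0 ∧ (∀ θ, 0 < U θ) ∧ (∀ t ∈ I, 0 < V t) ∧
    ∀ θ, ∀ t ∈ I,
      0 < lip (pdθ sp θ t) (pdθ sp θ t) ∧ 0 < lip (pdt sp θ t) (pdt sp θ t) ∧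
      pdθ sm θ t = (C * U θ / lip (pdθ sp θ t) (pdθ sp θ t)) • pdθ sp θ t ∧
      pdt sm θ t = (-(C * V t / lip (pdt sp θ t) (pdt sp θ t))) • pdt sp θ t

/-- `sp, sm` are Christoffel dual lifts of `⟨σp⟩, ⟨σm⟩`, scaled such that
`(s^±, p^±) = 0` and `(s^±, p^∓) = Δ`. -/
structure IsNormalizedDualLift (I : Set ℝ) (pp pm : R42) (Δ : ℝ)
    (σp σm sp sm : ℝ → ℝ → R42) : Prop where
  lift_p : IsSphereCongruence I sp ∧ SameCongruence I sp σp
  lift_m : IsSphereCongruence I sm ∧ SameCongruence I sm σm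
  dual : IsChristoffelDual I sp sm
  p_p : ∀ θ, ∀ t ∈ I, lip (sp θ t) pp = 0
  p_m : ∀ θ, ∀ t ∈ I, lip (sp θ t) pm = Δ
  m_m : ∀ θ, ∀ t ∈ I, lip (sm θ t) pm = 0
  m_p : ∀ θ, ∀ t ∈ I, lip (sm θ t) pp = Δ

/-- The polynomial `p_C(x) = κ⁻ x² + 2 C ε x + κ⁺ C²`. -/
def parPoly (κp κm ε C : ℝ) : Polynomial ℝ :=
  Polynomial.C κm * Polynomial.X ^ 2 + Polynomial.C (2 * C * ε) * Polynomial.X +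
    Polynomial.C (κp * C ^ 2)

end

/-!
Every vector of `Λ` is determined by its products with `p` and `q`, equivalently with `p^±`. Hence
the lifts `𝔰^±` with `(𝔰^±, p^±) = 0` and `(𝔰^±, p^∓) = Δ` exist, are unique, and are equivariant:
`𝔰^±(θ,t) = ρ₁(θ) c^±(t)` with profiles `c^± ⟂ e₁` (`eq_parRot_profile`). Only their Christoffel
duality is to be shown, and it comes from the curvature spheres. Put `r^± = -(c^±, v)`. Then
`α 𝔰⁺ + β 𝔰⁻` is a curvature sphere iff `α r⁺ + β r⁻ = 0` or `α c⁺' + β c⁻' = 0`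
(`section_differential_mem_iff`). The immersion condition makes each of these a single sphere, so
harmonic separation says that `r^± ≠ 0`, `c⁺' ≠ 0` and `r⁻ c⁺' + r⁺ c⁻' = 0`
(`profile_derivatives`). The `o`-component of the last equation is `(r⁺ r⁻)' = 0`, which gives the
constant `C = r⁺ r⁻`, and the equation itself is the duality in the direction of `t`, with the
correct sign.

Write `c⁺ = ρ₂(ψ)(-ε p⁺ + κ⁺ p⁻ + d v + r o)` with `r = r⁺` and `ψ = (c⁺, e₂) / r`; that `c⁺` is
lightlike determines `d`. The products of `c⁺` and `c⁻` and the orthogonality of `c⁺'` to both of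
them show that `(r', ψ')` is a non-zero multiple `μ` of `(z / s², w / s)`, where `s = √(-Δ)`,
`z² = p_C(r²)` and `w = (ε r² + κ⁺ C) / r²` (`profile_identities`); moreover `|c⁺'|² = (μ r)² > 0`.
Reparametrizing by the inverse of a primitive of `μ` (`exists_reparametrization`) gives the two
differential equations. The roots of `p_C` are real because `Δ < 0`, the plane `⟨p,q⟩` having
signature `(1,1)`.
-/

/-! ### The inner product of signature `(4,2)` and parabolic rotations -/

lemma lip_comm (x y : R42) : lip x y = lip y x := by unfold lip; ring

@[simp] lemma lip_add_left (x y z : R42) : lip (x + y) z = lip x z + lip y z := by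
  simp only [lip, Pi.add_apply]; ring

@[simp] lemma lip_sub_left (x y z : R42) : lip (x - y) z = lip x z - lip y z := by
  simp only [lip, Pi.sub_apply]; ring

@[simp] lemma lip_smul_left (a : ℝ) (x z : R42) : lip (a • x) z = a * lip x z := by
  simp only [lip, Pi.smul_apply, smul_eq_mul]; ring

@[simp] lemma lip_add_right (x y z : R42) : lip z (x + y) = lip z x + lip z y := by
  simp only [lip, Pi.add_apply]; ring

@[simp] lemma lip_sub_right (x y z : R42) : lip z (x - y) = lip z x - lip z y := by
  simp only [lip, Pi.sub_apply]; ring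

@[simp] lemma lip_smul_right (a : ℝ) (x z : R42) : lip z (a • x) = a * lip z x := by
  simp only [lip, Pi.smul_apply, smul_eq_mul]; ring

@[simp] lemma lip_zero_left (z : R42) : lip 0 z = 0 := by simp [lip]

@[simp] lemma lip_neg_left (x z : R42) : lip (-x) z = -lip x z := by
  simp only [lip, Pi.neg_apply]; ring

@[simp] lemma lip_neg_right (x z : R42) : lip z (-x) = -lip z x := by
  simp only [lip, Pi.neg_apply]; ring

/-- The inner product with a fixed vector, as a continuous linear functional. -/
noncomputable def lipCLM (y : R42) : R42 →L[ℝ] ℝ :=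
  LinearMap.toContinuousLinearMap
    { toFun := fun x => lip x y
      map_add' := fun a b => lip_add_left a b y
      map_smul' := fun c a => lip_smul_left c a y }

lemma HasDerivAt.lip_const {c : ℝ → R42} {c' : R42} {t : ℝ} (h : HasDerivAt c c' t) (y : R42) :
    HasDerivAt (fun t => lip (c t) y) (lip c' y) t :=
  (lipCLM y).hasFDerivAt.comp_hasDerivAt t h

lemma ContDiffOn.lip_const {E : Type*} [NormedAddCommGroup E] [NormedSpace ℝ E] {c : E → R42}
    {s : Set E} (h : ContDiffOn ℝ ∞ c s) (y : R42) :
    ContDiffOn ℝ ∞ (fun t => lip (c t) y) s :=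
  (lipCLM y).contDiff.comp_contDiffOn h

lemma eq_zero_of_forall_lip_eq_zero {x : R42} (h : ∀ y, lip x y = 0) : x = 0 := by
  funext i
  have := h (Pi.single i 1)
  fin_cases i <;> simpa [lip, Pi.single_apply] using this

/-- The parabolic rotation by a fixed angle, as a continuous linear map. -/
noncomputable def parRotCLM (v e : R42) (θ : ℝ) : R42 →L[ℝ] R42 :=
  LinearMap.toContinuousLinearMap
    { toFun := parRot v e θ
      map_add' := fun a b => by
        simp only [parRot, lip_add_left]; module
      map_smul' := fun c a => by
        simp only [parRot, lip_smul_left, RingHom.id_apply]; module }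

@[simp] lemma parRotCLM_apply (v e : R42) (θ : ℝ) (x : R42) :
    parRotCLM v e θ x = parRot v e θ x := rfl

lemma parRot_zero (v e x : R42) : parRot v e 0 x = x := by simp [parRot]

lemma lip_parRot {v e : R42} (hv : lip v v = 0) (he : lip e e = 1) (hve : lip v e = 0) (θ : ℝ)
    (x y : R42) : lip (parRot v e θ x) (parRot v e θ y) = lip x y := by
  simp only [parRot, lip_add_left, lip_add_right, lip_sub_left, lip_sub_right, lip_smul_left,
    lip_smul_right, hv, he, hve, lip_comm e v, lip_comm v y, lip_comm e y]
  ring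

lemma lip_parRot_of_orthogonal {v e y : R42} (hv : lip v y = 0) (he : lip e y = 0)
    (θ : ℝ) (x : R42) : lip (parRot v e θ x) y = lip x y := by
  simp [parRot, hv, he]

lemma hasDerivAt_parRot_angle {v e x : R42} (hx : lip x e = 0) (θ : ℝ) :
    HasDerivAt (fun θ => parRot v e θ x) ((-lip x v) • (e + θ • v)) θ := by
  have h1 : HasDerivAt (fun θ : ℝ => (θ * lip x v) • e) ((1 * lip x v) • e) θ :=
    ((hasDerivAt_id θ).mul_const _).smul_const e
  have h2 : HasDerivAt (fun θ : ℝ => (θ * lip x e - θ ^ 2 / 2 * lip x v) • v)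
      ((1 * lip x e - (2 * θ) / 2 * lip x v) • v) θ := by
    refine HasDerivAt.smul_const ?_ v
    refine ((hasDerivAt_id θ).mul_const _).sub ?_
    have := (((hasDerivAt_id θ).pow 2).div_const 2).mul_const (lip x v)
    simpa using this
  have h := (h1.const_sub x).add h2
  refine h.congr_deriv ?_
  rw [hx]
  module

namespace IsParabolicFrame

variable {p q v e₁ o e₂ : R42}

/-- Expansion in the pseudo-orthonormal basis. A vector orthogonal to all six basis vectors
vanishes, because six vectors with non-degenerate Gram matrix span `ℝ^{4,2}`. -/
lemma eq_expansion (h : IsParabolicFrame p q v e₁ o e₂) (hpq : IsHyperbolicSpaceForm p q)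
    {x : R42} (hp : lip x p = 0) (hq : lip x q = 0) (he : lip x e₁ = 0) :
    x = (-lip x o) • v + (-lip x v) • o + lip x e₂ • e₂ := by
  have hpp := hpq.pp
  have hpq' := hpq.pq
  have hqq := hpq.qq
  have hqp : lip q p = 0 := by rw [lip_comm, hpq']
  have hov : lip o v = -1 := by rw [lip_comm, h.vo]
  have hli : LinearIndependent ℝ ![p, q, v, e₁, o, e₂] := by
    rw [Fintype.linearIndependent_iff]
    intro g hg
    simp only [Fin.sum_univ_six, Matrix.cons_val] at hg
    have key := fun y => congrArg (fun z => lip z y) hg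
    simp only [lip_add_left, lip_smul_left, lip_zero_left] at key
    have k0 := key p
    have k1 := key q
    have k2 := key o
    have k3 := key e₁
    have k4 := key v
    have k5 := key e₂
    simp only [hpp, hqp, hpq', lip_comm v p, lip_comm e₁ p, lip_comm o p, lip_comm e₂ p,
      h.pv, h.pe₁, h.po, h.pe₂, lip_comm v q, lip_comm e₁ q, lip_comm o q, lip_comm e₂ q,
      h.qv, h.qe₁, h.qo, h.qe₂, h.vv, h.oo, h.vo, hov, h.e₁e₁, h.e₂e₂, h.ve₁, h.ve₂, h.oe₁,
      h.oe₂, h.e₁e₂, lip_comm e₁ v, lip_comm e₂ v, lip_comm e₁ o, lip_comm e₂ o,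
      lip_comm e₂ e₁, mul_zero, zero_add, add_zero, mul_one] at k0 k1 k2 k3 k4 k5
    have k1' : g 1 = 0 := (mul_eq_zero.1 k1).resolve_right hqq.ne'
    intro i
    fin_cases i <;> simp <;> linarith
  have hspan : Submodule.span ℝ (Set.range ![p, q, v, e₁, o, e₂]) = ⊤ :=
    hli.span_eq_top_of_card_eq_finrank (by simp)
  rw [← sub_eq_zero]
  apply eq_zero_of_forall_lip_eq_zero
  intro y
  have hy : y ∈ Submodule.span ℝ (Set.range ![p, q, v, e₁, o, e₂]) := hspan ▸ Submodule.mem_top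
  induction hy using Submodule.span_induction with
  | mem y hy =>
    obtain ⟨i, rfl⟩ := hy
    fin_cases i <;>
    simp [hp, hq, he, lip_comm v p, lip_comm o p, lip_comm e₂ p, h.pv, h.po, h.pe₂,
      lip_comm v q, lip_comm o q, lip_comm e₂ q, h.qv, h.qo, h.qe₂, h.vv, h.oo, h.vo, hov,
      h.e₂e₂, h.ve₁, h.ve₂, h.oe₁, h.oe₂, h.e₁e₂, lip_comm e₂ v, lip_comm e₂ o, lip_comm e₂ e₁]
  | zero => rw [lip_comm, lip_zero_left]
  | add a b _ _ ha hb => rw [lip_add_right, ha, hb, add_zero]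
  | smul c a _ ha => rw [lip_smul_right, ha, mul_zero]

end IsParabolicFrame

/-! ### The plane spanned by the sphere complexes -/

/-- Orthogonality to the sphere complexes `p^±` and to `p, q` are equivalent. -/
lemma lip_eq_zero_of_span_eq {p q pp pm : R42}
    (hplane : Submodule.span ℝ {pp, pm} = Submodule.span ℝ {p, q}) {x : R42}
    (h1 : lip x pp = 0) (h2 : lip x pm = 0) : lip x p = 0 ∧ lip x q = 0 := by
  have key : ∀ y ∈ Submodule.span ℝ {pp, pm}, lip x y = 0 := by
    intro y hy
    obtain ⟨a, b, rfl⟩ := Submodule.mem_span_pair.1 hy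
    simp [h1, h2]
  rw [hplane] at key
  exact ⟨key p (Submodule.subset_span (by simp)), key q (Submodule.subset_span (by simp))⟩

/-- `⟨p,q⟩` has signature `(1,1)`, so its Gram determinant in the basis `p^±` is negative. -/
lemma gram_det_neg {p q pp pm : R42} (hpq : IsHyperbolicSpaceForm p q)
    (hplane : Submodule.span ℝ {pp, pm} = Submodule.span ℝ {p, q}) :
    lip pp pp * lip pm pm - lip pp pm ^ 2 < 0 := by
  have h1 : pp ∈ Submodule.span ℝ {p, q} := hplane ▸ Submodule.subset_span (by simp)
  have h2 : pm ∈ Submodule.span ℝ {p, q} := hplane ▸ Submodule.subset_span (by simp)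
  have h3 : p ∈ Submodule.span ℝ {pp, pm} := hplane ▸ Submodule.subset_span (by simp)
  have h4 : q ∈ Submodule.span ℝ {pp, pm} := hplane ▸ Submodule.subset_span (by simp)
  obtain ⟨x, y, rfl⟩ := Submodule.mem_span_pair.1 h1
  obtain ⟨z, w, rfl⟩ := Submodule.mem_span_pair.1 h2
  obtain ⟨a, b, hp⟩ := Submodule.mem_span_pair.1 h3
  obtain ⟨c, d, hq⟩ := Submodule.mem_span_pair.1 h4
  have hqp : lip q p = 0 := by rw [lip_comm, hpq.pq]
  have hQ := hpq.qq
  have e1 := congrArg (fun z => lip z p) hp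
  have e2 := congrArg (fun z => lip z q) hp
  have e3 := congrArg (fun z => lip z p) hq
  have e4 := congrArg (fun z => lip z q) hq
  simp only [lip_add_left, lip_smul_left, hpq.pp, hpq.pq, hqp] at e1 e2 e3 e4
  have f1 : a * x + b * z = 1 := by linarith
  have f2 : a * y + b * w = 0 := by
    have : (a * y + b * w) * lip q q = 0 := by linarith
    exact (mul_eq_zero.1 this).resolve_right hQ.ne'
  have f3 : c * x + d * z = 0 := by linarith
  have f4 : c * y + d * w = 1 := by
    have : (c * y + d * w - 1) * lip q q = 0 := by linarith
    linarith [(mul_eq_zero.1 this).resolve_right hQ.ne']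
  have hdet : (a * d - b * c) * (x * w - y * z) = 1 := by
    linear_combination (c * y + d * w) * f1 - (c * x + d * z) * f2 + f4
  have hne : x * w - y * z ≠ 0 := by
    intro h; rw [h] at hdet; simp at hdet
  have : 0 < lip q q * (x * w - y * z) ^ 2 := by positivity
  simp only [lip_add_left, lip_smul_left, lip_add_right, lip_smul_right, hpq.pp, hpq.pq, hqp]
  nlinarith

/-! ### Reparametrization with prescribed speed -/

/-- A non-vanishing smooth function `μ` on an open interval is the speed of a change of
parameter: `τ` is inverse to a primitive of `μ`. -/
lemma exists_reparametrization {I : Set ℝ} (hIo : IsOpen I) (hIc : I.OrdConnected)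
    (hIn : I.Nonempty) {μ : ℝ → ℝ} (hμ : ContDiffOn ℝ ∞ μ I) (h0 : ∀ t ∈ I, μ t ≠ 0) :
    ∃ (J : Set ℝ) (τ : ℝ → ℝ), IsOpen J ∧ J.OrdConnected ∧ ContDiffOn ℝ ∞ τ J ∧ BijOn τ J I ∧
      ∀ t ∈ J, HasDerivAt τ (μ (τ t))⁻¹ t := by
  obtain ⟨t₀, ht₀⟩ := hIn
  set T : ℝ → ℝ := fun t => ∫ x in t₀..t, μ x with hT
  have hcont := hμ.continuousOn
  have hTd : ∀ t ∈ I, HasDerivAt T (μ t) t := fun t ht =>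
    intervalIntegral.integral_hasDerivAt_right
      ((hcont.mono (hIc.uIcc_subset ht₀ ht)).intervalIntegrable)
      (hcont.stronglyMeasurableAtFilter hIo t ht) (hcont.continuousAt (hIo.mem_nhds ht))
  have hTs : ContDiffOn ℝ ∞ T I := by
    rw [contDiffOn_infty_iff_deriv_of_isOpen hIo]
    exact ⟨fun t ht => (hTd t ht).differentiableAt.differentiableWithinAt,
      hμ.congr fun t ht => (hTd t ht).deriv⟩
  have hTc : ContinuousOn T I := hTs.continuousOn
  have hinj : InjOn T I := by
    have key : ∀ a ∈ I, ∀ b ∈ I, a < b → T a ≠ T b := by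
      intro a ha b hb hab h
      obtain ⟨c, hc, hc0⟩ := exists_hasDerivAt_eq_zero hab (hTc.mono (hIc.out ha hb)) h
        fun x hx => hTd x (hIc.out ha hb (Ioo_subset_Icc_self hx))
      exact h0 c (hIc.out ha hb (Ioo_subset_Icc_self hc)) hc0
    intro a ha b hb h
    rcases lt_trichotomy a b with hab | hab | hab
    · exact absurd h (key a ha b hb hab)
    · exact hab
    · exact absurd h.symm (key b hb a ha hab)
  have hopen : IsOpenMap (I.domRestrict T) := by
    rw [isOpenMap_iff_nhds_le]
    rintro ⟨t, ht⟩
    have hs : HasStrictDerivAt T (μ t) t :=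
      (hTs.contDiffAt (hIo.mem_nhds ht)).hasStrictDerivAt' (hTd t ht) (by simp)
    have h1 : Filter.map (I.domRestrict T) (nhds ⟨t, ht⟩) = Filter.map T (nhds t) := by
      rw [← map_nhds_subtype_coe_eq_nhds ht (hIo.mem_nhds ht), Filter.map_map]
      rfl
    rw [h1, hs.map_nhds_eq (h0 t ht)]
    rfl
  let e := OpenPartialHomeomorph.ofContinuousOpenRestrict (hinj.toPartialEquiv T I) hTc hopen hIo
  have hmem : ∀ t ∈ T '' I, e.symm t ∈ I := fun t ht => e.map_target ht
  refine ⟨T '' I, e.symm, e.open_target, ?_, ?_, ?_, ?_⟩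
  · exact (hIc.isPreconnected.image T hTc).ordConnected
  · exact fun t ht => (e.contDiffAt_symm_deriv (h0 _ (hmem t ht)) ht (hTd _ (hmem t ht))
      (hTs.contDiffAt (hIo.mem_nhds (hmem t ht)))).contDiffWithinAt
  · exact e.symm.bijOn
  · exact fun t ht => e.hasDerivAt_symm ht (h0 _ (hmem t ht)) (hTd _ (hmem t ht))

/-! ### The scalar identities for the profile curve -/

/-- The square of the remaining coordinate of `𝔰⁻` relative to the rotated frame is, up to scale,
the value `p_C(r²)`. Here `a, r, b` are the `v`-, `o`- and `e₂`-coordinates of the profile of `𝔰⁺`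
and `am, rm, bm` those of `𝔰⁻`. -/
lemma profile_sq_identity {κp κm ε Δ a r b am rm bm : ℝ}
    (h₁ : b ^ 2 - 2 * a * r = -(κp * Δ)) (h₂ : bm ^ 2 - 2 * am * rm = -(κm * Δ))
    (h₃ : b * bm - a * rm - am * r = ε * Δ) :
    (r * (r * bm - b * rm)) ^ 2 =
      -Δ * (κm * (r ^ 2) ^ 2 + 2 * (r * rm) * ε * r ^ 2 + κp * (r * rm) ^ 2) := by
  linear_combination r ^ 4 * h₂ + r ^ 2 * rm ^ 2 * h₁ - 2 * r ^ 3 * rm * h₃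

/-- Orthogonality of the velocity of one profile to the other one, in terms of `r` and of the
numerator `b' r - b r'` of the derivative of `b / r`. -/
lemma profile_velocity_identity {κp ε Δ a r b am rm bm a' r' b' am' rm' bm' : ℝ}
    (hrm : rm ≠ 0)
    (h₁ : b ^ 2 - 2 * a * r = -(κp * Δ))
    (h₃ : b * bm - a * rm - am * r = ε * Δ)
    (h₁' : b * b' = a' * r + a * r') (h₂' : bm * bm' = am' * rm + am * rm')
    (ha : rm * a' + r * am' = 0) (hr' : rm * r' + r * rm' = 0) (hb : rm * b' + r * bm' = 0) :
    -Δ * r' * (ε * r ^ 2 + κp * (r * rm)) = (b' * r - b * r') * (r * (r * bm - b * rm)) := by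
  have horth : bm * b' = a' * rm + am * r' := by
    have : rm * (bm * b' - a' * rm - am * r') = 0 := by
      linear_combination bm * hb - rm * ha - am * hr' - r * h₂'
    linarith [(mul_eq_zero.1 this).resolve_left hrm]
  linear_combination (-(r ^ 3)) * horth + r ^ 2 * rm * h₁' + r ^ 2 * r' * h₃ - r * r' * rm * h₁

/-- The numerators `ε r² + κ⁺ C` and `p_C(r²)` do not vanish simultaneously: otherwise `(r², C)` would lie in the kernel of the
Gram matrix of `p⁻, p⁺`, whose determinant is `Δ`. -/
lemma profile_direction_ne_zero {κp κm ε Δ C r : ℝ} (hΔ : Δ = κp * κm - ε ^ 2) (hΔ0 : Δ ≠ 0)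
    (hr : r ≠ 0) (hw : ε * r ^ 2 + κp * C = 0)
    (hz : κm * (r ^ 2) ^ 2 + 2 * C * ε * r ^ 2 + κp * C ^ 2 = 0) : False := by
  have k : κm * r ^ 2 + C * ε = 0 := by
    have : r ^ 2 * (κm * r ^ 2 + C * ε) = 0 := by linear_combination hz - C * hw
    exact (mul_eq_zero.1 this).resolve_left (pow_ne_zero 2 hr)
  have : Δ * r ^ 2 = 0 := by
    rw [hΔ]; linear_combination κp * k - ε * hw
  exact mul_ne_zero hΔ0 (pow_ne_zero 2 hr) this

/-- If `(x, y)` is parallel to `(m, n) ≠ 0`, then the factor is the normalized inner product. -/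
lemma eq_mul_of_parallel {x y m n μ : ℝ} (h : x * n = y * m) (hN : m ^ 2 + n ^ 2 ≠ 0)
    (hμ : μ = (x * m + y * n) / (m ^ 2 + n ^ 2)) : x = μ * m ∧ y = μ * n := by
  rw [hμ, div_mul_eq_mul_div, eq_div_iff hN, div_mul_eq_mul_div, eq_div_iff hN]
  constructor
  · linear_combination n * h
  · linear_combination (-m) * h

/-- The velocity of the profile of `𝔰⁺` has squared norm `(μ r)²`, where `μ • (z / s², w / s)` is
the velocity of `(r, b / r)`. -/
lemma profile_speed {κp κm ε Δ s C a r b a' r' b' z w ψ' μ : ℝ}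
    (hΔ : Δ = κp * κm - ε ^ 2) (hs0 : s ≠ 0) (hs2 : s ^ 2 = -Δ) (hr : r ≠ 0)
    (h₁ : b ^ 2 - 2 * a * r = -(κp * Δ)) (h₁' : b * b' = a' * r + a * r')
    (hz2 : z ^ 2 = κm * (r ^ 2) ^ 2 + 2 * C * ε * r ^ 2 + κp * C ^ 2)
    (hwr : w * r ^ 2 = ε * r ^ 2 + κp * C) (hψr : ψ' * r ^ 2 = b' * r - b * r')
    (hr' : r' = μ * (z / s ^ 2)) (hψ' : ψ' = μ * (w / s)) :
    b' ^ 2 - 2 * a' * r' = μ ^ 2 * r ^ 2 := by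
  have e1 : r ^ 2 * (b' ^ 2 - 2 * a' * r') = (ψ' * r ^ 2) ^ 2 + κp * Δ * r' ^ 2 := by
    rw [hψr]
    linear_combination 2 * r * r' * h₁' - r' ^ 2 * h₁
  have e2 : s ^ 4 * ((ψ' * r ^ 2) ^ 2 + κp * Δ * r' ^ 2) = s ^ 4 * (μ ^ 2 * r ^ 4) := by
    have f1 : s ^ 4 * (ψ' * r ^ 2) ^ 2 = μ ^ 2 * s ^ 2 * (w * r ^ 2) ^ 2 := by
      rw [hψ']; field_simp
    have f2 : s ^ 4 * r' ^ 2 = μ ^ 2 * z ^ 2 := by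
      rw [hr']; field_simp
    have hs4 : s ^ 4 = Δ ^ 2 := by linear_combination (s ^ 2 - Δ) * hs2
    calc s ^ 4 * ((ψ' * r ^ 2) ^ 2 + κp * Δ * r' ^ 2)
        = s ^ 4 * (ψ' * r ^ 2) ^ 2 + κp * Δ * (s ^ 4 * r' ^ 2) := by ring
      _ = s ^ 4 * (μ ^ 2 * r ^ 4) := by
        rw [f1, f2, hwr, hz2, hs4, hs2, hΔ]; ring
  have e3 := mul_left_cancel₀ (pow_ne_zero 4 hs0) e2
  refine mul_left_cancel₀ (pow_ne_zero 2 hr) ?_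
  rw [e1, e3]; ring

/-- Pointwise form of the two differential equations: with `z² = p_C(r²)` and
`w = (ε r² + κ⁺ C) / r²`, the velocity of `(r, b / r)` is a non-zero multiple of
`(z / s², w / s)`, where `s = √(-Δ)`. -/
lemma profile_identities {κp κm ε Δ s C a r b am rm bm a' r' b' am' rm' bm' : ℝ}
    (hΔ : Δ = κp * κm - ε ^ 2) (hs0 : s ≠ 0) (hs2 : s ^ 2 = -Δ)
    (hr : r ≠ 0) (hrm : rm ≠ 0) (hC : r * rm = C)
    (h₁ : b ^ 2 - 2 * a * r = -(κp * Δ)) (h₂ : bm ^ 2 - 2 * am * rm = -(κm * Δ))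
    (h₃ : b * bm - a * rm - am * r = ε * Δ)
    (h₁' : b * b' = a' * r + a * r') (h₂' : bm * bm' = am' * rm + am * rm')
    (ha : rm * a' + r * am' = 0) (hr' : rm * r' + r * rm' = 0) (hb : rm * b' + r * bm' = 0)
    (hne : ¬(a' = 0 ∧ r' = 0 ∧ b' = 0)) {z w ψ' μ : ℝ}
    (hz : z = r * (r * bm - b * rm) / s) (hw : w = (ε * r ^ 2 + κp * C) / r ^ 2)
    (hψ' : ψ' = (b' * r - b * r') / r ^ 2)
    (hμ : μ = (r' * (z / s ^ 2) + ψ' * (w / s)) / ((z / s ^ 2) ^ 2 + (w / s) ^ 2)) :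
    (z / s ^ 2) ^ 2 + (w / s) ^ 2 ≠ 0 ∧
    z ^ 2 = κm * (r ^ 2) ^ 2 + 2 * C * ε * r ^ 2 + κp * C ^ 2 ∧
    r' = μ * (z / s ^ 2) ∧ ψ' = μ * (w / s) ∧ μ ≠ 0 ∧
    b' ^ 2 - 2 * a' * r' = μ ^ 2 * r ^ 2 := by
  have hzs : z * s = r * (r * bm - b * rm) := by rw [hz, div_mul_cancel₀ _ hs0]
  have hwr : w * r ^ 2 = ε * r ^ 2 + κp * C := by rw [hw, div_mul_cancel₀ _ (pow_ne_zero 2 hr)]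
  have hψr : ψ' * r ^ 2 = b' * r - b * r' := by rw [hψ', div_mul_cancel₀ _ (pow_ne_zero 2 hr)]
  have hΔ0 : Δ ≠ 0 := fun h => pow_ne_zero 2 hs0 (by rw [hs2, h, neg_zero])
  have hz2 : z ^ 2 = κm * (r ^ 2) ^ 2 + 2 * C * ε * r ^ 2 + κp * C ^ 2 := by
    have e := profile_sq_identity h₁ h₂ h₃
    rw [← hzs, hC, ← hs2, mul_pow, mul_comm] at e
    exact mul_left_cancel₀ (pow_ne_zero 2 hs0) e
  have hpar : r' * (w / s) = ψ' * (z / s ^ 2) := by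
    have e := profile_velocity_identity hrm h₁ h₃ h₁' h₂' ha hr' hb
    rw [← hzs, hC, ← hs2, ← hwr, ← hψr] at e
    have e' : r' * s * w = ψ' * z := by
      have : (s * r ^ 2) * (r' * s * w) = (s * r ^ 2) * (ψ' * z) := by linear_combination e
      exact mul_left_cancel₀ (mul_ne_zero hs0 (pow_ne_zero 2 hr)) this
    field_simp
    linear_combination e'
  have hN : (z / s ^ 2) ^ 2 + (w / s) ^ 2 ≠ 0 := by
    intro h
    obtain ⟨hz0, hw0⟩ := (add_eq_zero_iff_of_nonneg (sq_nonneg _) (sq_nonneg _)).1 h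
    simp only [ne_eq, OfNat.ofNat_ne_zero, not_false_eq_true, pow_eq_zero_iff, div_eq_zero_iff,
      hs0, or_false] at hz0 hw0
    rw [hw0, zero_mul] at hwr
    rw [hz0] at hz2
    exact profile_direction_ne_zero hΔ hΔ0 hr hwr.symm (by rw [← hz2]; ring)
  obtain ⟨hr'μ, hψ'μ⟩ := eq_mul_of_parallel hpar hN hμ
  have hμ0 : μ ≠ 0 := by
    intro h
    rw [h, zero_mul] at hr'μ hψ'μ
    rw [hr'μ, hψ'μ] at hψr
    have hb0 : b' = 0 := by
      have : b' * r = 0 := by linarith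
      exact (mul_eq_zero.1 this).resolve_right hr
    rw [hb0, hr'μ] at h₁'
    have ha0 : a' = 0 := by
      have : a' * r = 0 := by linarith
      exact (mul_eq_zero.1 this).resolve_right hr
    exact hne ⟨ha0, hr'μ, hb0⟩
  exact ⟨hN, hz2, hr'μ, hψ'μ, hμ0, profile_speed hΔ hs0 hs2 hr h₁ h₁' hz2 hwr hψr hr'μ hψ'μ⟩

/-- The roots of `p_C`; they are real because `Δ < 0`. -/
lemma parPoly_roots {κp κm ε Δ s C : ℝ} (hΔ : Δ = κp * κm - ε ^ 2) (hs2 : s ^ 2 = -Δ)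
    (hκm : κm ≠ 0) :
    (parPoly κp κm ε C).roots = {C * (-ε + s) / κm, C * (-ε - s) / κm} ∧
    ∀ x, κm * x ^ 2 + 2 * C * ε * x + κp * C ^ 2 =
      κm * (x - C * (-ε + s) / κm) * (x - C * (-ε - s) / κm) := by
  have hsum : κm * (C * (-ε + s) / κm + C * (-ε - s) / κm) = -(2 * C * ε) := by
    field_simp; ring
  have hprod : κm * ((C * (-ε + s) / κm) * (C * (-ε - s) / κm)) = κp * C ^ 2 := by
    field_simp; linear_combination -C ^ 2 * hs2 + C ^ 2 * hΔ
  generalize C * (-ε + s) / κm = x₁ at *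
  generalize C * (-ε - s) / κm = x₂ at *
  constructor
  · have : parPoly κp κm ε C =
        Polynomial.C κm * ((Polynomial.X - Polynomial.C x₁) * (Polynomial.X - Polynomial.C x₂)) := by
      have h1 : 2 * C * ε = -(κm * (x₁ + x₂)) := by linarith
      rw [parPoly, ← hprod, h1]
      simp only [map_mul, map_neg, map_add]
      ring
    rw [this, Polynomial.roots_C_mul _ hκm, Polynomial.roots_mul
      (mul_ne_zero (Polynomial.X_sub_C_ne_zero _) (Polynomial.X_sub_C_ne_zero _)),
      Polynomial.roots_X_sub_C, Polynomial.roots_X_sub_C]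
    rfl
  · intro x
    linear_combination x * hsum - hprod

/-! ### Adapted lifts of a Legendre immersion -/

/-- Lifts `sp, sm` of the sphere congruences of `Λ` in the complexes `p^±`, scaled by
`(s^±, p^∓) = Δ`. Unlike `IsNormalizedDualLift`, duality is not part of the definition. -/
structure IsAdaptedPair (I : Set ℝ) (Λ : ℝ → ℝ → Submodule ℝ R42) (pp pm : R42) (Δ : ℝ)
    (sp sm : ℝ → ℝ → R42) : Prop where
  smooth_p : SmoothOnStrip I sp
  smooth_m : SmoothOnStrip I sm
  mem_p : ∀ θ, ∀ t ∈ I, sp θ t ∈ Λ θ t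
  mem_m : ∀ θ, ∀ t ∈ I, sm θ t ∈ Λ θ t
  p_p : ∀ θ, ∀ t ∈ I, lip (sp θ t) pp = 0
  p_m : ∀ θ, ∀ t ∈ I, lip (sp θ t) pm = Δ
  m_m : ∀ θ, ∀ t ∈ I, lip (sm θ t) pm = 0
  m_p : ∀ θ, ∀ t ∈ I, lip (sm θ t) pp = Δ

section Legendre

variable {p q pp pm : R42} {I : Set ℝ} {f n : ℝ → ℝ → R42} {Λ : ℝ → ℝ → Submodule ℝ R42}

lemma IsLegendreLift.eq_of_mem (hΛ : IsLegendreLift p q I f n Λ) {θ t : ℝ} (ht : t ∈ I) {x : R42}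
    (hx : x ∈ Λ θ t) : x = (-lip x q) • f θ t + (-lip x p) • n θ t := by
  rw [hΛ.span_eq θ t ht] at hx
  obtain ⟨a, b, rfl⟩ := Submodule.mem_span_pair.1 hx
  obtain ⟨-, h1, h2⟩ := hΛ.f_mem θ t ht
  obtain ⟨-, h3, h4⟩ := hΛ.n_mem θ t ht
  simp [h1, h2, h3, h4]

lemma IsLegendreLift.eq_zero_of_mem (hΛ : IsLegendreLift p q I f n Λ)
    (hplane : Submodule.span ℝ {pp, pm} = Submodule.span ℝ {p, q}) {θ t : ℝ} (ht : t ∈ I)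
    {x : R42} (hx : x ∈ Λ θ t) (h1 : lip x pp = 0) (h2 : lip x pm = 0) : x = 0 := by
  obtain ⟨hp, hq⟩ := lip_eq_zero_of_span_eq hplane h1 h2
  rw [hΛ.eq_of_mem ht hx, hp, hq]
  simp

lemma IsLegendreLift.lip_eq_zero (hΛ : IsLegendreLift p q I f n Λ) {θ t : ℝ} (ht : t ∈ I)
    {x y : R42} (hx : x ∈ Λ θ t) (hy : y ∈ Λ θ t) : lip x y = 0 := by
  rw [hΛ.span_eq θ t ht] at hx hy
  obtain ⟨a, b, rfl⟩ := Submodule.mem_span_pair.1 hx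
  obtain ⟨c, d, rfl⟩ := Submodule.mem_span_pair.1 hy
  have h1 := (hΛ.f_mem θ t ht).1
  have h2 := (hΛ.n_mem θ t ht).1
  have h3 := hΛ.contact θ t ht
  simp [h1, h2, h3, lip_comm (n θ t) (f θ t)]

/-- `Λ` has a smooth section with prescribed constant products with `p^±`, namely a combination of
`f` and `n` with constant coefficients. -/
lemma IsLegendreLift.exists_section (hΛ : IsLegendreLift p q I f n Λ)
    (hplane : Submodule.span ℝ {pp, pm} = Submodule.span ℝ {p, q}) (P : R42) :
    ∃ s : ℝ → ℝ → R42, SmoothOnStrip I s ∧ Envelopes I Λ s ∧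
      ∀ θ, ∀ t ∈ I, lip (s θ t) pp = lip P pp ∧ lip (s θ t) pm = lip P pm := by
  refine ⟨fun θ t => (-lip P q) • f θ t + (-lip P p) • n θ t, ?_, ?_, ?_⟩
  · exact (hΛ.smooth_f.const_smul _).add (hΛ.smooth_n.const_smul _)
  · intro θ t ht
    rw [hΛ.span_eq θ t ht]
    exact Submodule.mem_span_pair.2 ⟨_, _, rfl⟩
  · intro θ t ht
    obtain ⟨-, h1, h2⟩ := hΛ.f_mem θ t ht
    obtain ⟨-, h3, h4⟩ := hΛ.n_mem θ t ht
    have := lip_eq_zero_of_span_eq hplane.symm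
      (x := (-lip P q) • f θ t + (-lip P p) • n θ t - P) (by simp [h1, h3]) (by simp [h2, h4])
    simpa only [lip_sub_left, sub_eq_zero] using this

lemma IsLegendreLift.exists_adaptedPair (hΛ : IsLegendreLift p q I f n Λ)
    (hplane : Submodule.span ℝ {pp, pm} = Submodule.span ℝ {p, q}) {κp κm ε Δ : ℝ}
    (hκp : κp = lip pp pp) (hκm : κm = lip pm pm) (hε : ε = lip pp pm)
    (hΔ : Δ = κp * κm - ε ^ 2) : ∃ sp sm, IsAdaptedPair I Λ pp pm Δ sp sm := by
  obtain ⟨sp, h1, h2, h3⟩ := hΛ.exists_section hplane ((-ε) • pp + κp • pm)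
  obtain ⟨sm, h4, h5, h6⟩ := hΛ.exists_section hplane (κm • pp + (-ε) • pm)
  simp only [lip_add_left, lip_smul_left, lip_comm pm pp, ← hκp, ← hκm, ← hε] at h3 h6
  refine ⟨sp, sm, h1, h4, h2, h5, ?_, ?_, ?_, ?_⟩ <;> intro θ t ht
  · rw [(h3 θ t ht).1]; ring
  · rw [(h3 θ t ht).2, hΔ]; ring
  · rw [(h6 θ t ht).2]; ring
  · rw [(h6 θ t ht).1, hΔ]; ring

lemma IsAdaptedPair.eq_of_mem {Δ : ℝ} {sp sm : ℝ → ℝ → R42}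
    (hs : IsAdaptedPair I Λ pp pm Δ sp sm) (hΔ0 : Δ ≠ 0) (hΛ : IsLegendreLift p q I f n Λ)
    (hplane : Submodule.span ℝ {pp, pm} = Submodule.span ℝ {p, q}) {θ t : ℝ} (ht : t ∈ I)
    {x : R42} (hx : x ∈ Λ θ t) :
    x = (lip x pm / Δ) • sp θ t + (lip x pp / Δ) • sm θ t := by
  rw [← sub_eq_zero]
  refine hΛ.eq_zero_of_mem hplane ht (Submodule.sub_mem _ hx (Submodule.add_mem _
    (Submodule.smul_mem _ _ (hs.mem_p θ t ht)) (Submodule.smul_mem _ _ (hs.mem_m θ t ht)))) ?_ ?_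
  · simp [hs.p_p θ t ht, hs.m_p θ t ht, hΔ0]
  · simp [hs.p_m θ t ht, hs.m_m θ t ht, hΔ0]

lemma SmoothOnStrip.differentiableAt {s : ℝ → ℝ → R42} (hs : SmoothOnStrip I s) (hI : IsOpen I)
    {t : ℝ} (ht : t ∈ I) (θ : ℝ) :
    DifferentiableAt ℝ (fun x : ℝ × ℝ => s x.1 x.2) (θ, t) :=
  (hs.contDiffAt ((isOpen_univ.prod hI).mem_nhds ⟨mem_univ _, ht⟩)).differentiableAt (by simp)

lemma SmoothOnStrip.hasDerivAt_pdθ {s : ℝ → ℝ → R42} (hs : SmoothOnStrip I s) (hI : IsOpen I)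
    {t : ℝ} (ht : t ∈ I) (θ : ℝ) : HasDerivAt (fun θ => s θ t) (pdθ s θ t) θ := by
  have : DifferentiableAt ℝ (fun θ' : ℝ => (θ', t)) θ := by fun_prop
  exact ((hs.differentiableAt hI ht θ).comp θ this).hasDerivAt

lemma SmoothOnStrip.hasDerivAt_pdt {s : ℝ → ℝ → R42} (hs : SmoothOnStrip I s) (hI : IsOpen I)
    {t : ℝ} (ht : t ∈ I) (θ : ℝ) : HasDerivAt (fun t => s θ t) (pdt s θ t) t := by
  have : DifferentiableAt ℝ (fun t' : ℝ => (θ, t')) t := by fun_prop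
  exact ((hs.differentiableAt hI ht θ).comp t this).hasDerivAt

lemma SmoothOnStrip.profile {s : ℝ → ℝ → R42} (hs : SmoothOnStrip I s) :
    ContDiffOn ℝ ∞ (s 0) I := by
  have : ContDiffOn ℝ ∞ (fun t : ℝ => ((0 : ℝ), t)) I := by fun_prop
  exact ContDiffOn.comp (g := fun x : ℝ × ℝ => s x.1 x.2) hs this fun t ht => ⟨mem_univ _, ht⟩

lemma HasDerivAt.lip_eq_zero_of_const {c : ℝ → R42} {c' y : R42} {t k : ℝ} {U : Set ℝ}
    (hU : IsOpen U) (ht : t ∈ U) (h : HasDerivAt c c' t) (hk : ∀ t ∈ U, lip (c t) y = k) :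
    lip c' y = 0 := by
  have h1 : HasDerivAt (fun _ : ℝ => k) (lip c' y) t :=
    (h.lip_const y).congr_of_eventuallyEq
      (Filter.eventually_of_mem (hU.mem_nhds ht) fun u hu => (hk u hu).symm)
  exact h1.unique (hasDerivAt_const t k)

/-- Derivative of a linear combination of two curves with coefficients determined by inner
products: the derivatives of the coefficients only contribute to the span of the two curves. -/
lemma deriv_combination_mem {c x y : ℝ → R42} {c' x' y' : R42} {t Δ : ℝ}
    {L : Submodule ℝ R42} (hc : HasDerivAt c c' t) (hx : HasDerivAt x x' t)
    (hy : HasDerivAt y y' t) (hxL : x t ∈ L) (hyL : y t ∈ L)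
    (h : ∀ᶠ u in nhds t, c u = (lip (c u) pm / Δ) • x u + (lip (c u) pp / Δ) • y u) :
    c' - ((lip (c t) pm / Δ) • x' + (lip (c t) pp / Δ) • y') ∈ L := by
  have h1 := ((hc.lip_const pm).div_const Δ).smul hx
  have h2 := ((hc.lip_const pp).div_const Δ).smul hy
  have h3 := hc.unique ((h1.add h2).congr_of_eventuallyEq h)
  rw [h3]
  have : ∀ a b c d : R42, a + b + (c + d) - (a + c) = b + d := fun a b c d => by abel
  rw [this]
  exact L.add_mem (L.smul_mem _ hxL) (L.smul_mem _ hyL)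

end Legendre

/-! ### Rotational invariance -/

section Rotational

variable {p q pp pm v e₁ o e₂ : R42} {I : Set ℝ} {f n : ℝ → ℝ → R42}
  {Λ : ℝ → ℝ → Submodule ℝ R42} {Δ : ℝ} {sp sm : ℝ → ℝ → R42}

lemma IsParabolicRotational.parRot_mem (hrot : IsParabolicRotational v e₁ I Λ) {t : ℝ}
    (ht : t ∈ I) {x : R42} (hx : x ∈ Λ 0 t) (θ : ℝ) : parRot v e₁ θ x ∈ Λ θ t := by
  obtain ⟨c₁, c₂, -, -, h⟩ := hrot
  rw [h 0 t ht, parRot_zero, parRot_zero] at hx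
  obtain ⟨a, b, rfl⟩ := Submodule.mem_span_pair.1 hx
  simp only [h θ t ht, ← parRotCLM_apply, map_add, map_smul]
  exact Submodule.mem_span_pair.2 ⟨a, b, rfl⟩

lemma IsParabolicRotational.lip_eq_zero (hrot : IsParabolicRotational v e₁ I Λ) {t : ℝ}
    (ht : t ∈ I) {x : R42} (hx : x ∈ Λ 0 t) : lip x e₁ = 0 := by
  obtain ⟨c₁, c₂, h1, h2, h⟩ := hrot
  rw [h 0 t ht, parRot_zero, parRot_zero] at hx
  obtain ⟨a, b, rfl⟩ := Submodule.mem_span_pair.1 hx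
  simp [h1.planar t ht, h2.planar t ht]

/-- A section of `Λ` that has constant products with `p^±` is equivariant. -/
lemma eq_parRot_profile (hΛ : IsLegendreLift p q I f n Λ)
    (hplane : Submodule.span ℝ {pp, pm} = Submodule.span ℝ {p, q})
    (hrot : IsParabolicRotational v e₁ I Λ) (hframe : IsParabolicFrame p q v e₁ o e₂)
    {s : ℝ → ℝ → R42} (hs : Envelopes I Λ s) {t a b : ℝ} (ht : t ∈ I)
    (ha : ∀ θ, lip (s θ t) pp = a) (hb : ∀ θ, lip (s θ t) pm = b) (θ : ℝ) :
    s θ t = parRot v e₁ θ (s 0 t) := by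
  obtain ⟨hv1, hv2⟩ := lip_eq_zero_of_span_eq hplane.symm (x := v)
    (by rw [lip_comm, hframe.pv]) (by rw [lip_comm, hframe.qv])
  obtain ⟨he1, he2⟩ := lip_eq_zero_of_span_eq hplane.symm (x := e₁)
    (by rw [lip_comm, hframe.pe₁]) (by rw [lip_comm, hframe.qe₁])
  rw [← sub_eq_zero]
  refine hΛ.eq_zero_of_mem hplane ht
    (Submodule.sub_mem _ (hs θ t ht) (hrot.parRot_mem ht (hs 0 t ht) θ)) ?_ ?_
  · rw [lip_sub_left, lip_parRot_of_orthogonal hv1 he1, ha, ha, sub_self]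
  · rw [lip_sub_left, lip_parRot_of_orthogonal hv2 he2, hb, hb, sub_self]

/-- The partial derivatives of an equivariant map with planar profile. -/
lemma pd_of_equivariant (hI : IsOpen I) {s : ℝ → ℝ → R42} (hs : SmoothOnStrip I s)
    (hplanar : ∀ t ∈ I, lip (s 0 t) e₁ = 0)
    (heq : ∀ θ, ∀ t ∈ I, s θ t = parRot v e₁ θ (s 0 t)) (θ : ℝ) {t : ℝ} (ht : t ∈ I) :
    pdθ s θ t = (-lip (s 0 t) v) • (e₁ + θ • v) ∧
    pdt s θ t = parRot v e₁ θ (pdt s 0 t) := by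
  constructor
  · have : (fun θ => s θ t) = fun θ => parRot v e₁ θ (s 0 t) := funext fun θ => heq θ t ht
    rw [pdθ, this, (hasDerivAt_parRot_angle (hplanar t ht) θ).deriv]
  · have h1 : HasDerivAt (fun t => parRot v e₁ θ (s 0 t)) (parRot v e₁ θ (pdt s 0 t)) t :=
      (parRotCLM v e₁ θ).hasFDerivAt.comp_hasDerivAt t (hs.hasDerivAt_pdt hI ht 0)
    exact (h1.congr_of_eventuallyEq
      (Filter.eventually_of_mem (hI.mem_nhds ht) fun u hu => heq θ u hu)).deriv

/-- Along the profile, the differential of a section `s = α sp + β sm` maps the direction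
`a ∂_θ + b ∂_t` into `Λ` iff its rotational part, a multiple of `e₁`, and its meridian part, which
is orthogonal to `e₁`, both vanish after discarding the derivatives of `α` and `β`. -/
lemma section_differential_mem_iff (hΔ0 : Δ ≠ 0) (hI : IsOpen I)
    (hΛ : IsLegendreLift p q I f n Λ)
    (hplane : Submodule.span ℝ {pp, pm} = Submodule.span ℝ {p, q})
    (hrot : IsParabolicRotational v e₁ I Λ) (hframe : IsParabolicFrame p q v e₁ o e₂)
    (hs : IsAdaptedPair I Λ pp pm Δ sp sm) {s : ℝ → ℝ → R42} (hsm : SmoothOnStrip I s)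
    (hse : Envelopes I Λ s) {t : ℝ} (ht : t ∈ I) (a b : ℝ) :
    a • pdθ s 0 t + b • pdt s 0 t ∈ Λ 0 t ↔
      a * (lip (s 0 t) pm / Δ * lip (sp 0 t) v + lip (s 0 t) pp / Δ * lip (sm 0 t) v) = 0 ∧
      b • ((lip (s 0 t) pm / Δ) • pdt sp 0 t + (lip (s 0 t) pp / Δ) • pdt sm 0 t) = 0 := by
  have hmem := fun θ {t} ht => hs.eq_of_mem hΔ0 hΛ hplane ht (hse θ t ht)
  have h1 := deriv_combination_mem (hsm.hasDerivAt_pdθ hI ht 0)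
    (hs.smooth_p.hasDerivAt_pdθ hI ht 0) (hs.smooth_m.hasDerivAt_pdθ hI ht 0)
    (hs.mem_p 0 t ht) (hs.mem_m 0 t ht) (Filter.Eventually.of_forall fun θ => hmem θ ht)
  have h2 := deriv_combination_mem (hsm.hasDerivAt_pdt hI ht 0)
    (hs.smooth_p.hasDerivAt_pdt hI ht 0) (hs.smooth_m.hasDerivAt_pdt hI ht 0)
    (hs.mem_p 0 t ht) (hs.mem_m 0 t ht)
    (Filter.eventually_of_mem (hI.mem_nhds ht) fun u hu => hmem 0 hu)
  have hpl := fun t ht => hrot.lip_eq_zero ht (hs.mem_p 0 t ht)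
  have hpl' := fun t ht => hrot.lip_eq_zero ht (hs.mem_m 0 t ht)
  have hp := (pd_of_equivariant hI hs.smooth_p hpl (fun θ t ht => eq_parRot_profile hΛ hplane hrot
    hframe hs.mem_p ht (fun θ => hs.p_p θ t ht) (fun θ => hs.p_m θ t ht) θ) 0 ht).1
  have hm := (pd_of_equivariant hI hs.smooth_m hpl' (fun θ t ht => eq_parRot_profile hΛ hplane hrot
    hframe hs.mem_m ht (fun θ => hs.m_p θ t ht) (fun θ => hs.m_m θ t ht) θ) 0 ht).1
  rw [hp, hm] at h1
  have hdp := hs.smooth_p.hasDerivAt_pdt hI ht 0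
  have hdm := hs.smooth_m.hasDerivAt_pdt hI ht 0
  have z1 := hdp.lip_eq_zero_of_const hI ht (hs.p_p 0)
  have z2 := hdp.lip_eq_zero_of_const hI ht (hs.p_m 0)
  have z3 := hdm.lip_eq_zero_of_const hI ht (hs.m_p 0)
  have z4 := hdm.lip_eq_zero_of_const hI ht (hs.m_m 0)
  have z5 := hdp.lip_eq_zero_of_const hI ht hpl
  have z6 := hdm.lip_eq_zero_of_const hI ht hpl'
  obtain ⟨he1, he2⟩ := lip_eq_zero_of_span_eq hplane.symm (x := e₁)
    (by rw [lip_comm, hframe.pe₁]) (by rw [lip_comm, hframe.qe₁])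
  generalize lip (s 0 t) pm / Δ = α at *
  generalize lip (s 0 t) pp / Δ = β at *
  have hsum := (Λ 0 t).add_mem ((Λ 0 t).smul_mem a h1) ((Λ 0 t).smul_mem b h2)
  set y : R42 := (-(a * (α * lip (sp 0 t) v + β * lip (sm 0 t) v))) • e₁ +
    b • (α • pdt sp 0 t + β • pdt sm 0 t) with hy
  have hdiff : a • pdθ s 0 t + b • pdt s 0 t ∈ Λ 0 t ↔ y ∈ Λ 0 t := by
    rw [← Submodule.add_mem_iff_right (Λ 0 t) hsum (y := y), hy]
    refine iff_of_eq (congrArg (· ∈ Λ 0 t) ?_)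
    module
  rw [hdiff]
  constructor
  · intro h
    have hy0 : y = 0 := hΛ.eq_zero_of_mem hplane ht h (by simp [hy, he1, z1, z3])
      (by simp [hy, he2, z2, z4])
    have h3 := congrArg (fun x => lip x e₁) hy0
    simp only [hy, lip_add_left, lip_smul_left, hframe.e₁e₁, z5, z6, lip_zero_left] at h3
    have h4 : a * (α * lip (sp 0 t) v + β * lip (sm 0 t) v) = 0 := by linarith
    rw [hy, h4] at hy0
    exact ⟨h4, by simpa using hy0⟩
  · rintro ⟨h3, h4⟩
    rw [hy, h3, h4]
    simp

end Rotational

/-! ### The profile curves of the two sphere congruences -/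

section Profile

variable {p q pp pm v e₁ o e₂ : R42} {I : Set ℝ} {f n : ℝ → ℝ → R42}
  {Λ : ℝ → ℝ → Submodule ℝ R42} {Δ : ℝ} {sp sm σp σm : ℝ → ℝ → R42}

/-- The curvature spheres of `Λ` at `(0,t)` are `α sp + β sm` with either `α r⁺ + β r⁻ = 0` or
`α c⁺' + β c⁻' = 0`, where `c^±` are the profiles and `r^± = -(c^±, v)`. Each of these conditions
determines one point of the projective line, by the immersion condition, and harmonic separation
relates the two points by `β ↦ -β`. -/
lemma profile_derivatives (hΔ0 : Δ ≠ 0) (hI : IsOpen I)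
    (hΛ : IsLegendreLift p q I f n Λ)
    (hplane : Submodule.span ℝ {pp, pm} = Submodule.span ℝ {p, q})
    (hrot : IsParabolicRotational v e₁ I Λ) (hframe : IsParabolicFrame p q v e₁ o e₂)
    (hLW : IsLinearWeingarten I Λ pp pm σp σm)
    (hs : IsAdaptedPair I Λ pp pm Δ sp sm) {t : ℝ} (ht : t ∈ I) :
    lip (sp 0 t) v ≠ 0 ∧ lip (sm 0 t) v ≠ 0 ∧
    lip (sm 0 t) v • pdt sp 0 t + lip (sp 0 t) v • pdt sm 0 t = 0 ∧ pdt sp 0 t ≠ 0 := by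
  have hiff := fun {s} (h1 : SmoothOnStrip I s) (h2 : Envelopes I Λ s) (a b : ℝ) =>
    section_differential_mem_iff hΔ0 hI hΛ hplane hrot hframe hs h1 h2 ht a b
  obtain ⟨s₁, s₂, ⟨hs₁, hs₁e, hs₁c⟩, ⟨hs₂, hs₂e, hs₂c⟩, hharm⟩ := hLW.omega.harmonic
  -- the immersion condition excludes a constant meridian or rotational part
  have him1 : ¬(lip (sp 0 t) v = 0 ∧ lip (sm 0 t) v = 0) := by
    rintro ⟨h1, h2⟩
    exact one_ne_zero (hΛ.immersion 0 t ht 1 0 fun s hs hse =>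
      (hiff hs hse 1 0).2 (by simp [h1, h2])).1
  have him2 : ¬(pdt sp 0 t = 0 ∧ pdt sm 0 t = 0) := by
    rintro ⟨h1, h2⟩
    exact one_ne_zero (hΛ.immersion 0 t ht 0 1 fun s hs hse =>
      (hiff hs hse 0 1).2 (by simp [h1, h2])).2
  have hcurv : ∀ {s : ℝ → ℝ → R42}, IsSphereCongruence I s → Envelopes I Λ s →
      (∃ a b : ℝ, (a ≠ 0 ∨ b ≠ 0) ∧ a • pdθ s 0 t + b • pdt s 0 t ∈ Λ 0 t) →
      lip (s 0 t) pm * lip (sp 0 t) v + lip (s 0 t) pp * lip (sm 0 t) v = 0 ∨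
        lip (s 0 t) pm • pdt sp 0 t + lip (s 0 t) pp • pdt sm 0 t = 0 := by
    rintro s h1 h2 ⟨a, b, hab, hmem⟩
    obtain ⟨h3, h4⟩ := (hiff h1.smooth h2 a b).1 hmem
    rcases hab with ha | hb
    · left
      have := (mul_eq_zero.1 h3).resolve_left ha
      field_simp at this
      rwa [mul_zero] at this
    · right
      have := (smul_eq_zero.1 h4).resolve_left hb
      have h5 := congrArg (fun x => Δ • x) this
      simpa only [smul_add, smul_smul, mul_div_cancel₀ _ hΔ0, smul_zero] using h5
  have hc1 := hcurv hs₁ hs₁e (hs₁c 0 t ht)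
  have hc2 := hcurv hs₂ hs₂e (hs₂c 0 t ht)
  obtain ⟨hlin, x, y, hx, hy, hsp1, hsp2⟩ := hharm 0 t ht
  have hzero : lip (σp 0 t) pp = 0 := hLW.complex_p 0 t ht
  have hzero' : lip (σm 0 t) pm = 0 := hLW.complex_m 0 t ht
  have hσp : σp 0 t ∈ Λ 0 t := by
    rw [hLW.omega.span_eq 0 t ht]; exact Submodule.subset_span (by simp)
  have hσm : σm 0 t ∈ Λ 0 t := by
    rw [hLW.omega.span_eq 0 t ht]; exact Submodule.subset_span (by simp)
  have hk : lip (σp 0 t) pm ≠ 0 := fun h =>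
    hlin.ne_zero 0 (hΛ.eq_zero_of_mem hplane ht hσp hzero h)
  have hl : lip (σm 0 t) pp ≠ 0 := fun h =>
    hlin.ne_zero 1 (hΛ.eq_zero_of_mem hplane ht hσm h hzero')
  have hmul : ∀ {z w : R42}, z ≠ 0 → Submodule.span ℝ {z} = Submodule.span ℝ {w} →
      ∃ u : ℝ, u ≠ 0 ∧ z = u • w := by
    intro z w hz h
    obtain ⟨u, hu⟩ := Submodule.mem_span_singleton.1
      (h ▸ Submodule.mem_span_singleton_self z : z ∈ Submodule.span ℝ {w})
    refine ⟨u, ?_, hu.symm⟩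
    rintro rfl
    exact hz (by rw [← hu, zero_smul])
  obtain ⟨u₁, hu₁, e1⟩ := hmul (hs₁.ne_zero 0 t ht) hsp1
  obtain ⟨u₂, hu₂, e2⟩ := hmul (hs₂.ne_zero 0 t ht) hsp2
  rw [e1] at hc1
  rw [e2] at hc2
  simp only [lip_add_left, lip_sub_left, lip_smul_left, hzero, hzero'] at hc1 hc2
  obtain ⟨A, hA, hA'⟩ : ∃ A, A ≠ 0 ∧ A = x * lip (σp 0 t) pm := ⟨_, mul_ne_zero hx hk, rfl⟩
  obtain ⟨B, hB, hB'⟩ : ∃ B, B ≠ 0 ∧ B = y * lip (σm 0 t) pp := ⟨_, mul_ne_zero hy hl, rfl⟩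
  rw [← hA', ← hB'] at hc1 hc2
  generalize lip (sp 0 t) v = r at *
  generalize lip (sm 0 t) v = ρ at *
  generalize pdt sp 0 t = X at *
  generalize pdt sm 0 t = Y at *
  have d1 : A * r + B * ρ = 0 ∨ A • X + B • Y = 0 := by
    refine hc1.imp (fun h => mul_left_cancel₀ hu₁ ?_) (fun h => smul_right_injective _ hu₁ ?_)
    · linear_combination h
    · simp only [smul_zero]; rw [← h]; module
  have d2 : A * r - B * ρ = 0 ∨ A • X - B • Y = 0 := by
    refine hc2.imp (fun h => mul_left_cancel₀ hu₂ ?_) (fun h => smul_right_injective _ hu₂ ?_)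
    · linear_combination h
    · simp only [smul_zero]; rw [← h]; module
  clear hc1 hc2
  have final : ∀ B : ℝ, B ≠ 0 → A * r + B * ρ = 0 → A • X - B • Y = 0 →
      r ≠ 0 ∧ ρ ≠ 0 ∧ ρ • X + r • Y = 0 ∧ X ≠ 0 := by
    intro B hB h1 h2
    have hr : r ≠ 0 := by
      rintro rfl
      exact him1 ⟨rfl, by simpa [hB] using h1⟩
    have hρ : ρ ≠ 0 := by
      rintro rfl
      exact hr (by simpa [hA] using h1)
    refine ⟨hr, hρ, smul_right_injective _ hB ?_, ?_⟩
    · simp only [smul_zero]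
      have : B • (ρ • X + r • Y) = (A * r + B * ρ) • X - r • (A • X - B • Y) := by module
      rw [this, h1, h2]; simp
    · rintro rfl
      exact him2 ⟨rfl, by simpa [hB] using h2⟩
  rcases d1 with h1 | h1 <;> rcases d2 with h2 | h2
  · have h3 : A * r = 0 := by linarith
    have h4 : B * ρ = 0 := by linarith
    exact absurd ⟨(mul_eq_zero.1 h3).resolve_left hA, (mul_eq_zero.1 h4).resolve_left hB⟩ him1
  · exact final B hB h1 h2
  · refine final (-B) (neg_ne_zero.2 hB) (by linarith) ?_
    rw [← h1]; module
  · have h3 : (2 * A) • X = 0 := by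
      have : (2 * A) • X = (A • X + B • Y) + (A • X - B • Y) := by module
      rw [this, h1, h2, add_zero]
    have h4 : (2 * B) • Y = 0 := by
      have : (2 * B) • Y = (A • X + B • Y) - (A • X - B • Y) := by module
      rw [this, h1, h2, sub_zero]
    exact absurd ⟨(smul_eq_zero.1 h3).resolve_left (by simpa using hA),
      (smul_eq_zero.1 h4).resolve_left (by simpa using hB)⟩ him2

end Profile

/-! ### Coordinates of the profile curves -/

section Coordinates

variable {p q pp pm v e₁ o e₂ : R42}

lemma IsParabolicFrame.lip_of_mem_span (h : IsParabolicFrame p q v e₁ o e₂) {P : R42}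
    (hP : P ∈ Submodule.span ℝ {p, q}) :
    lip P v = 0 ∧ lip P o = 0 ∧ lip P e₁ = 0 ∧ lip P e₂ = 0 := by
  obtain ⟨a, b, rfl⟩ := Submodule.mem_span_pair.1 hP
  simp [h.pv, h.po, h.pe₁, h.pe₂, h.qv, h.qo, h.qe₁, h.qe₂]

/-- A planar vector is determined by its products with `p^±` and its coordinates in the frame. -/
lemma IsParabolicFrame.eq_add_expansion (h : IsParabolicFrame p q v e₁ o e₂)
    (hpq : IsHyperbolicSpaceForm p q)
    (hplane : Submodule.span ℝ {pp, pm} = Submodule.span ℝ {p, q}) {x P : R42}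
    (hP : P ∈ Submodule.span ℝ {pp, pm}) (h1 : lip x pp = lip P pp) (h2 : lip x pm = lip P pm)
    (h3 : lip x e₁ = 0) :
    x = P + (-lip x o) • v + (-lip x v) • o + lip x e₂ • e₂ := by
  rw [hplane] at hP
  obtain ⟨k1, k2, k3, k4⟩ := h.lip_of_mem_span hP
  obtain ⟨hp, hq⟩ := lip_eq_zero_of_span_eq hplane (x := x - P) (by simp [h1]) (by simp [h2])
  have := h.eq_expansion hpq hp hq (by simp [h3, k3])
  simp only [lip_sub_left, k1, k2, k4, sub_zero] at this
  linear_combination this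

lemma IsParabolicFrame.lip_add_expansion (h : IsParabolicFrame p q v e₁ o e₂) {P Q : R42}
    (hP : P ∈ Submodule.span ℝ {p, q}) (hQ : Q ∈ Submodule.span ℝ {p, q})
    (a r b a' r' b' : ℝ) :
    lip (P + a • v + r • o + b • e₂) (Q + a' • v + r' • o + b' • e₂) =
      lip P Q + (b * b' - a * r' - a' * r) := by
  obtain ⟨k1, k2, k3, k4⟩ := h.lip_of_mem_span hP
  obtain ⟨l1, l2, l3, l4⟩ := h.lip_of_mem_span hQ
  simp only [lip_add_left, lip_smul_left, lip_add_right, lip_smul_right, k1, k2, k4,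
    lip_comm v Q, lip_comm o Q, lip_comm e₂ Q, l1, l2, l4, h.vv, h.oo, h.vo, lip_comm o v,
    h.ve₂, h.oe₂, lip_comm e₂ v, lip_comm e₂ o, h.e₂e₂]
  ring

end Coordinates

/-! ### The differential equations of the profile -/

section ProfileODE

variable {p q pp pm v e₁ o e₂ : R42} {I : Set ℝ} {f n : ℝ → ℝ → R42}
  {Λ : ℝ → ℝ → Submodule ℝ R42} {Δ : ℝ} {sp sm σp σm : ℝ → ℝ → R42}

/-- The product `r⁺ r⁻` of the `o`-coordinates of the two profiles is constant: by
`profile_derivatives` its derivative vanishes. -/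
lemma exists_profile_constant (hΔ0 : Δ ≠ 0) (hI : IsOpen I) (hIc : I.OrdConnected)
    (hIn : I.Nonempty) (hΛ : IsLegendreLift p q I f n Λ)
    (hplane : Submodule.span ℝ {pp, pm} = Submodule.span ℝ {p, q})
    (hrot : IsParabolicRotational v e₁ I Λ) (hframe : IsParabolicFrame p q v e₁ o e₂)
    (hLW : IsLinearWeingarten I Λ pp pm σp σm)
    (hs : IsAdaptedPair I Λ pp pm Δ sp sm) :
    ∃ C : ℝ, C ≠ 0 ∧ ∀ t ∈ I, lip (sp 0 t) v * lip (sm 0 t) v = C := by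
  have hprof := fun {t} ht =>
    profile_derivatives hΔ0 hI hΛ hplane hrot hframe hLW hs (t := t) ht
  have hd : ∀ t ∈ I, HasDerivAt (fun t => lip (sp 0 t) v * lip (sm 0 t) v) 0 t := by
    intro t ht
    refine (((hs.smooth_p.hasDerivAt_pdt hI ht 0).lip_const v).mul
      ((hs.smooth_m.hasDerivAt_pdt hI ht 0).lip_const v)).congr_deriv ?_
    have := congrArg (fun x => lip x v) (hprof ht).2.2.1
    simp only [lip_add_left, lip_smul_left, lip_zero_left] at this
    linarith
  obtain ⟨C, hC⟩ := hI.exists_is_const_of_deriv_eq_zero hIc.isPreconnected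
    (fun t ht => (hd t ht).differentiableAt.differentiableWithinAt) (fun t ht => (hd t ht).deriv)
  refine ⟨C, ?_, hC⟩
  obtain ⟨t, ht⟩ := hIn
  rw [← hC t ht]
  exact mul_ne_zero (hprof ht).1 (hprof ht).2.1

/-- The velocity of the profile. Here `r = -(c⁺, v)` and `ψ = (c⁺, e₂) / r` are the radius and the
angle of the profile `c⁺` with respect to the rotations `ρ₂`. After division by `μ`, their
derivatives satisfy the differential equations in the theorem. -/
lemma exists_profile_speed (hpq : IsHyperbolicSpaceForm p q) (hI : IsOpen I)
    (hΛ : IsLegendreLift p q I f n Λ)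
    (hplane : Submodule.span ℝ {pp, pm} = Submodule.span ℝ {p, q})
    (hrot : IsParabolicRotational v e₁ I Λ) (hframe : IsParabolicFrame p q v e₁ o e₂)
    (hLW : IsLinearWeingarten I Λ pp pm σp σm)
    (hs : IsAdaptedPair I Λ pp pm Δ sp sm) {κp κm ε C : ℝ}
    (hκp : κp = lip pp pp) (hκm : κm = lip pm pm) (hε : ε = lip pp pm)
    (hΔ : Δ = κp * κm - ε ^ 2) (hC : ∀ t ∈ I, lip (sp 0 t) v * lip (sm 0 t) v = C)
    {r ψ : ℝ → ℝ} (hr : r = fun t => -lip (sp 0 t) v)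
    (hψ : ψ = fun t => lip (sp 0 t) e₂ / r t) :
    ∃ μ ζ : ℝ → ℝ, ContDiffOn ℝ ∞ μ I ∧ ∀ t ∈ I, μ t ≠ 0 ∧
      ζ t ^ 2 = (κm * (r t ^ 2) ^ 2 + 2 * C * ε * r t ^ 2 + κp * C ^ 2) / Δ ^ 2 ∧
      HasDerivAt r (μ t * ζ t) t ∧
      HasDerivAt ψ (μ t * (√(-(1 / Δ)) * ((ε * r t ^ 2 + κp * C) / r t ^ 2))) t ∧
      lip (pdt sp 0 t) (pdt sp 0 t) = μ t ^ 2 * r t ^ 2 ∧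
      sp 0 t = (-ε) • pp + κp • pm + (-lip (sp 0 t) o) • v + r t • o + (r t * ψ t) • e₂ ∧
      -lip (sp 0 t) o = κp * Δ / (2 * r t) + r t * ψ t ^ 2 / 2 := by
  have hΔneg : Δ < 0 := by rw [hΔ, hκp, hκm, hε]; exact gram_det_neg hpq hplane
  set s : ℝ := √(-Δ) with hsdef
  have hs0 : s ≠ 0 := (Real.sqrt_pos.2 (by linarith)).ne'
  have hs2 : s ^ 2 = -Δ := Real.sq_sqrt (by linarith)
  have hsinv : √(-(1 / Δ)) = 1 / s := by
    rw [hsdef, show -(1 / Δ) = (-Δ)⁻¹ by rw [one_div, inv_neg], Real.sqrt_inv, one_div]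
  have hprof := fun {t} ht =>
    profile_derivatives hΔneg.ne hI hΛ hplane hrot hframe hLW hs (t := t) ht
  -- coordinates of the two profiles
  set a : ℝ → ℝ := fun t => -lip (sp 0 t) o with ha
  set b : ℝ → ℝ := fun t => lip (sp 0 t) e₂ with hb
  set am : ℝ → ℝ := fun t => -lip (sm 0 t) o with ham
  set rm : ℝ → ℝ := fun t => -lip (sm 0 t) v with hrm
  set bm : ℝ → ℝ := fun t => lip (sm 0 t) e₂ with hbm
  have hPmem : (-ε) • pp + κp • pm ∈ Submodule.span ℝ {pp, pm} :=
    Submodule.mem_span_pair.2 ⟨_, _, rfl⟩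
  have hQmem : κm • pp + (-ε) • pm ∈ Submodule.span ℝ {pp, pm} :=
    Submodule.mem_span_pair.2 ⟨_, _, rfl⟩
  have hxp : ∀ t ∈ I, sp 0 t =
      (-ε) • pp + κp • pm + a t • v + r t • o + b t • e₂ := by
    intro t ht
    rw [hr]
    refine hframe.eq_add_expansion hpq hplane hPmem ?_ ?_ (hrot.lip_eq_zero ht (hs.mem_p 0 t ht))
    · rw [hs.p_p 0 t ht, lip_add_left, lip_smul_left, lip_smul_left, lip_comm pm, ← hκp, ← hε]
      ring
    · rw [hs.p_m 0 t ht, lip_add_left, lip_smul_left, lip_smul_left, ← hκm, ← hε, hΔ]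
      ring
  have hxm : ∀ t ∈ I, sm 0 t =
      κm • pp + (-ε) • pm + am t • v + rm t • o + bm t • e₂ := by
    intro t ht
    refine hframe.eq_add_expansion hpq hplane hQmem ?_ ?_ (hrot.lip_eq_zero ht (hs.mem_m 0 t ht))
    · rw [hs.m_p 0 t ht, lip_add_left, lip_smul_left, lip_smul_left, lip_comm pm, ← hκp, ← hε, hΔ]
      ring
    · rw [hs.m_m 0 t ht, lip_add_left, lip_smul_left, lip_smul_left, ← hκm, ← hε]
      ring
  have hPP : lip ((-ε) • pp + κp • pm) ((-ε) • pp + κp • pm) = κp * Δ := by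
    simp only [lip_add_left, lip_add_right, lip_smul_left, lip_smul_right, lip_comm pm pp, ← hκp,
      ← hκm, ← hε, hΔ]; ring
  have hQQ : lip (κm • pp + (-ε) • pm) (κm • pp + (-ε) • pm) = κm * Δ := by
    simp only [lip_add_left, lip_add_right, lip_smul_left, lip_smul_right, lip_comm pm pp, ← hκp,
      ← hκm, ← hε, hΔ]; ring
  have hPQ : lip ((-ε) • pp + κp • pm) (κm • pp + (-ε) • pm) = -(ε * Δ) := by
    simp only [lip_add_left, lip_add_right, lip_smul_left, lip_smul_right, lip_comm pm pp, ← hκp,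
      ← hκm, ← hε, hΔ]; ring
  rw [hplane] at hPmem hQmem
  have h₁ : ∀ t ∈ I, b t ^ 2 - 2 * a t * r t = -(κp * Δ) := by
    intro t ht
    have := hΛ.lip_eq_zero ht (hs.mem_p 0 t ht) (hs.mem_p 0 t ht)
    rw [hxp t ht, hframe.lip_add_expansion hPmem hPmem, hPP] at this
    linarith
  have h₂ : ∀ t ∈ I, bm t ^ 2 - 2 * am t * rm t = -(κm * Δ) := by
    intro t ht
    have := hΛ.lip_eq_zero ht (hs.mem_m 0 t ht) (hs.mem_m 0 t ht)
    rw [hxm t ht, hframe.lip_add_expansion hQmem hQmem, hQQ] at this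
    linarith
  have h₃ : ∀ t ∈ I, b t * bm t - a t * rm t - am t * r t = ε * Δ := by
    intro t ht
    have := hΛ.lip_eq_zero ht (hs.mem_p 0 t ht) (hs.mem_m 0 t ht)
    rw [hxp t ht, hxm t ht, hframe.lip_add_expansion hPmem hQmem, hPQ] at this
    linarith
  -- their derivatives
  have hdp : ∀ t ∈ I, HasDerivAt (sp 0) (pdt sp 0 t) t :=
    fun t ht => hs.smooth_p.hasDerivAt_pdt hI ht 0
  have hdm : ∀ t ∈ I, HasDerivAt (sm 0) (pdt sm 0 t) t :=
    fun t ht => hs.smooth_m.hasDerivAt_pdt hI ht 0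
  have da : ∀ t ∈ I, HasDerivAt a (-lip (pdt sp 0 t) o) t :=
    fun t ht => ((hdp t ht).lip_const o).neg
  have dr : ∀ t ∈ I, HasDerivAt r (-lip (pdt sp 0 t) v) t :=
    fun t ht => hr ▸ ((hdp t ht).lip_const v).neg
  have db : ∀ t ∈ I, HasDerivAt b (lip (pdt sp 0 t) e₂) t :=
    fun t ht => (hdp t ht).lip_const e₂
  have dam : ∀ t ∈ I, HasDerivAt am (-lip (pdt sm 0 t) o) t :=
    fun t ht => ((hdm t ht).lip_const o).neg
  have drm : ∀ t ∈ I, HasDerivAt rm (-lip (pdt sm 0 t) v) t :=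
    fun t ht => ((hdm t ht).lip_const v).neg
  have dbm : ∀ t ∈ I, HasDerivAt bm (lip (pdt sm 0 t) e₂) t :=
    fun t ht => (hdm t ht).lip_const e₂
  have hdiff : ∀ {a r b : ℝ → ℝ} {a' r' b' k t : ℝ}, t ∈ I → HasDerivAt a a' t →
      HasDerivAt r r' t → HasDerivAt b b' t → (∀ t ∈ I, b t ^ 2 - 2 * a t * r t = k) →
      b t * b' = a' * r t + a t * r' := by
    intro a r b a' r' b' k t ht da dr db h
    have h1 := (db.pow 2).sub ((da.const_mul 2).mul dr)
    have h2 := h1.unique ((hasDerivAt_const t k).congr_of_eventuallyEq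
      (Filter.eventually_of_mem (hI.mem_nhds ht) h))
    simp only [Nat.cast_ofNat, Nat.add_one_sub_one, pow_one] at h2
    linarith
  have hpair : ∀ t ∈ I, ∀ y, lip (sm 0 t) v * lip (pdt sp 0 t) y +
      lip (sp 0 t) v * lip (pdt sm 0 t) y = 0 := by
    intro t ht y
    have := congrArg (fun x => lip x y) (hprof ht).2.2.1
    simpa using this
  have hexp : ∀ t ∈ I, pdt sp 0 t = 0 + (-lip (pdt sp 0 t) o) • v + (-lip (pdt sp 0 t) v) • o +
      lip (pdt sp 0 t) e₂ • e₂ := by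
    intro t ht
    refine hframe.eq_add_expansion hpq hplane (Submodule.zero_mem _) ?_ ?_ ?_
    · rw [lip_zero_left]; exact (hdp t ht).lip_eq_zero_of_const hI ht (hs.p_p 0)
    · rw [lip_zero_left]; exact (hdp t ht).lip_eq_zero_of_const hI ht (hs.p_m 0)
    · exact (hdp t ht).lip_eq_zero_of_const hI ht
        fun t ht => hrot.lip_eq_zero ht (hs.mem_p 0 t ht)
  have hr0 : ∀ t ∈ I, r t ≠ 0 := fun t ht => by rw [hr]; exact neg_ne_zero.2 (hprof ht).1
  let z : ℝ → ℝ := fun t => r t * (r t * bm t - b t * rm t) / s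
  let w : ℝ → ℝ := fun t => (ε * r t ^ 2 + κp * C) / r t ^ 2
  let ψ' : ℝ → ℝ := fun t => (deriv b t * r t - b t * deriv r t) / r t ^ 2
  let μ : ℝ → ℝ := fun t => (deriv r t * (z t / s ^ 2) + ψ' t * (w t / s)) /
    ((z t / s ^ 2) ^ 2 + (w t / s) ^ 2)
  have key : ∀ t ∈ I, _ := fun t ht => profile_identities (z := z t) (w := w t) (ψ' := ψ' t)
    (μ := μ t) hΔ hs0 hs2 (hr0 t ht)
    (neg_ne_zero.2 (hprof ht).2.1) (rm := rm t) (C := C)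
    (by rw [hr, hrm]; simpa using hC t ht)
    (h₁ t ht) (h₂ t ht) (h₃ t ht) (hdiff ht (da t ht) (dr t ht) (db t ht) h₁)
    (hdiff ht (dam t ht) (drm t ht) (dbm t ht) h₂)
    (by rw [hr, hrm]; linear_combination hpair t ht o)
    (by rw [hr, hrm]; linear_combination hpair t ht v)
    (by rw [hr, hrm]; linear_combination -hpair t ht e₂)
    (by
      rintro ⟨k1, k2, k3⟩
      apply (hprof ht).2.2.2
      rw [hexp t ht, k1, k2, k3]
      simp)
    rfl rfl (by rw [← (dr t ht).deriv, ← (db t ht).deriv]) (by rw [← (dr t ht).deriv])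
  have sr : ContDiffOn ℝ ∞ r I := hr ▸ (hs.smooth_p.profile.lip_const v).neg
  have sb : ContDiffOn ℝ ∞ b I := hs.smooth_p.profile.lip_const e₂
  have srm : ContDiffOn ℝ ∞ rm I := (hs.smooth_m.profile.lip_const v).neg
  have sbm : ContDiffOn ℝ ∞ bm I := hs.smooth_m.profile.lip_const e₂
  have sr' : ContDiffOn ℝ ∞ (deriv r) I := ((contDiffOn_infty_iff_deriv_of_isOpen hI).1 sr).2
  have sb' : ContDiffOn ℝ ∞ (deriv b) I := ((contDiffOn_infty_iff_deriv_of_isOpen hI).1 sb).2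
  have sz : ContDiffOn ℝ ∞ z I := (sr.mul ((sr.mul sbm).sub (sb.mul srm))).div_const s
  have sw : ContDiffOn ℝ ∞ w I :=
    ((contDiffOn_const.mul (sr.pow 2)).add contDiffOn_const).div (sr.pow 2)
      fun t ht => pow_ne_zero 2 (hr0 t ht)
  have sψ' : ContDiffOn ℝ ∞ ψ' I :=
    ((sb'.mul sr).sub (sb.mul sr')).div (sr.pow 2) fun t ht => pow_ne_zero 2 (hr0 t ht)
  have sμ : ContDiffOn ℝ ∞ μ I :=
    ((sr'.mul (sz.div_const _)).add (sψ'.mul (sw.div_const _))).div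
      (((sz.div_const _).pow 2).add ((sw.div_const _).pow 2)) fun t ht => (key t ht).1
  refine ⟨μ, fun t => z t / s ^ 2, sμ, fun t ht => ?_⟩
  obtain ⟨-, k1, k2, k3, k4, k5⟩ := key t ht
  have hrt := hr0 t ht
  have hbr : r t * ψ t = b t := by rw [hψ]; exact mul_div_cancel₀ _ hrt
  refine ⟨k4, ?_, ?_, ?_, ?_, ?_, ?_⟩
  · rw [div_pow, k1, hs2, neg_sq]
  · rw [← k2]; exact dr t ht
  · have := (db t ht).div (dr t ht) hrt
    rw [← (db t ht).deriv, ← (dr t ht).deriv] at this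
    rw [hψ]
    refine this.congr_deriv ?_
    change ψ' t = _
    rw [k3, hsinv]
    change μ t * (w t / s) = μ t * (1 / s * w t)
    ring
  · have h0 := hframe.lip_add_expansion (Submodule.zero_mem _) (Submodule.zero_mem _)
      (-lip (pdt sp 0 t) o) (-lip (pdt sp 0 t) v) (lip (pdt sp 0 t) e₂)
      (-lip (pdt sp 0 t) o) (-lip (pdt sp 0 t) v) (lip (pdt sp 0 t) e₂)
    rw [← hexp t ht, lip_zero_left] at h0
    rw [h0, ← k5]; ring
  · rw [hbr]; exact hxp t ht
  · have h4 := h₁ t ht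
    rw [← hbr] at h4
    change a t = _
    field_simp
    linear_combination -h4

end ProfileODE

/-! ### Christoffel duality -/

section Duality

variable {p q pp pm v e₁ o e₂ : R42} {I : Set ℝ} {f n : ℝ → ℝ → R42}
  {Λ : ℝ → ℝ → Submodule ℝ R42} {Δ : ℝ} {sp sm σp σm : ℝ → ℝ → R42}

lemma IsNormalizedDualLift.isAdaptedPair (hLW : IsLinearWeingarten I Λ pp pm σp σm)
    (h : IsNormalizedDualLift I pp pm Δ σp σm sp sm) : IsAdaptedPair I Λ pp pm Δ sp sm where
  smooth_p := h.lift_p.1.smooth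
  smooth_m := h.lift_m.1.smooth
  mem_p θ t ht := by
    have h1 : sp θ t ∈ Submodule.span ℝ {σp θ t} :=
      h.lift_p.2 θ t ht ▸ Submodule.mem_span_singleton_self _
    rw [hLW.omega.span_eq θ t ht]
    exact Submodule.span_mono (by simp) h1
  mem_m θ t ht := by
    have h1 : sm θ t ∈ Submodule.span ℝ {σm θ t} :=
      h.lift_m.2 θ t ht ▸ Submodule.mem_span_singleton_self _
    rw [hLW.omega.span_eq θ t ht]
    exact Submodule.span_mono (by simp) h1
  p_p := h.p_p
  p_m := h.p_m
  m_m := h.m_m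
  m_p := h.m_p

/-- Adapted lifts are equivariant, so their partial derivatives are determined by the profiles. -/
lemma IsAdaptedPair.pd_eq (hI : IsOpen I) (hΛ : IsLegendreLift p q I f n Λ)
    (hplane : Submodule.span ℝ {pp, pm} = Submodule.span ℝ {p, q})
    (hrot : IsParabolicRotational v e₁ I Λ) (hframe : IsParabolicFrame p q v e₁ o e₂)
    (hs : IsAdaptedPair I Λ pp pm Δ sp sm) (θ : ℝ) {t : ℝ} (ht : t ∈ I) :
    (pdθ sp θ t = (-lip (sp 0 t) v) • (e₁ + θ • v) ∧
      pdt sp θ t = parRot v e₁ θ (pdt sp 0 t)) ∧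
    (pdθ sm θ t = (-lip (sm 0 t) v) • (e₁ + θ • v) ∧
      pdt sm θ t = parRot v e₁ θ (pdt sm 0 t)) :=
  ⟨pd_of_equivariant hI hs.smooth_p (fun t ht => hrot.lip_eq_zero ht (hs.mem_p 0 t ht))
    (fun θ t ht => eq_parRot_profile hΛ hplane hrot hframe hs.mem_p ht (fun θ => hs.p_p θ t ht)
      (fun θ => hs.p_m θ t ht) θ) θ ht,
  pd_of_equivariant hI hs.smooth_m (fun t ht => hrot.lip_eq_zero ht (hs.mem_m 0 t ht))
    (fun θ t ht => eq_parRot_profile hΛ hplane hrot hframe hs.mem_m ht (fun θ => hs.m_p θ t ht)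
      (fun θ => hs.m_m θ t ht) θ) θ ht⟩

/-- The rotational half of Christoffel duality, with `U = 1`. -/
lemma IsAdaptedPair.pdθ_dual (hΔ0 : Δ ≠ 0) (hI : IsOpen I) (hΛ : IsLegendreLift p q I f n Λ)
    (hplane : Submodule.span ℝ {pp, pm} = Submodule.span ℝ {p, q})
    (hrot : IsParabolicRotational v e₁ I Λ) (hframe : IsParabolicFrame p q v e₁ o e₂)
    (hLW : IsLinearWeingarten I Λ pp pm σp σm)
    (hs : IsAdaptedPair I Λ pp pm Δ sp sm) {C : ℝ}
    (hC : ∀ t ∈ I, lip (sp 0 t) v * lip (sm 0 t) v = C) (θ : ℝ) {t : ℝ} (ht : t ∈ I) :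
    0 < lip (pdθ sp θ t) (pdθ sp θ t) ∧
    pdθ sm θ t = (C / lip (pdθ sp θ t) (pdθ sp θ t)) • pdθ sp θ t := by
  obtain ⟨⟨h1, -⟩, ⟨h2, -⟩⟩ := hs.pd_eq hI hΛ hplane hrot hframe θ ht
  have hr := (profile_derivatives hΔ0 hI hΛ hplane hrot hframe hLW hs ht).1
  have h3 : lip (pdθ sp θ t) (pdθ sp θ t) = lip (sp 0 t) v ^ 2 := by
    simp only [h1, lip_smul_left, lip_smul_right, lip_add_left, lip_add_right, hframe.e₁e₁,
      hframe.vv, hframe.ve₁, lip_comm e₁ v]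
    ring
  rw [h3, h2, h1, ← hC t ht, smul_smul]
  refine ⟨by positivity, ?_⟩
  congr 1
  field_simp

/-- Adapted lifts are Christoffel dual, with `U = 1` and `V = μ²`: the sign of the relation
`r⁻ c⁺' + r⁺ c⁻' = 0` between the profiles is the one required in the direction of `t`. -/
lemma IsAdaptedPair.isNormalizedDualLift (hpq : IsHyperbolicSpaceForm p q) (hI : IsOpen I)
    (hIc : I.OrdConnected) (hIn : I.Nonempty) (hΛ : IsLegendreLift p q I f n Λ)
    (hplane : Submodule.span ℝ {pp, pm} = Submodule.span ℝ {p, q})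
    (hrot : IsParabolicRotational v e₁ I Λ) (hframe : IsParabolicFrame p q v e₁ o e₂)
    (hLW : IsLinearWeingarten I Λ pp pm σp σm)
    (hs : IsAdaptedPair I Λ pp pm Δ sp sm) {κp κm ε : ℝ}
    (hκp : κp = lip pp pp) (hκm : κm = lip pm pm) (hε : ε = lip pp pm)
    (hΔ : Δ = κp * κm - ε ^ 2) : IsNormalizedDualLift I pp pm Δ σp σm sp sm := by
  have hΔ0 : Δ ≠ 0 := by rw [hΔ, hκp, hκm, hε]; exact (gram_det_neg hpq hplane).ne
  obtain ⟨C, hC0, hC⟩ :=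
    exists_profile_constant hΔ0 hI hIc hIn hΛ hplane hrot hframe hLW hs
  obtain ⟨μ, ζ, -, hμ⟩ := exists_profile_speed hpq hI hΛ hplane hrot hframe hLW hs hκp hκm hε hΔ hC
    rfl rfl
  have hspan : ∀ {x y : R42} {k : ℝ}, x = k • y → x ≠ 0 →
      Submodule.span ℝ {y} = Submodule.span ℝ {x} := by
    rintro x y k rfl hx
    have hk : k ≠ 0 := by rintro rfl; simp at hx
    exact (Submodule.span_singleton_smul_eq hk.isUnit y).symm
  refine ⟨⟨⟨hs.smooth_p, ?_, ?_⟩, ?_⟩, ⟨⟨hs.smooth_m, ?_, ?_⟩, ?_⟩, ⟨C, fun _ => 1, fun t => μ t ^ 2,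
    hC0, fun _ => one_pos, ?_, ?_⟩, hs.p_p, hs.p_m, hs.m_m, hs.m_p⟩
  · intro θ t ht h
    have := hs.p_m θ t ht
    rw [h, lip_zero_left] at this
    exact hΔ0 this.symm
  · exact fun θ t ht => hΛ.lip_eq_zero ht (hs.mem_p θ t ht) (hs.mem_p θ t ht)
  · intro θ t ht
    have hmem : σp θ t ∈ Λ θ t := by
      rw [hLW.omega.span_eq θ t ht]; exact Submodule.subset_span (by simp)
    have := hs.eq_of_mem hΔ0 hΛ hplane ht hmem
    rw [hLW.complex_p θ t ht, zero_div, zero_smul, add_zero] at this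
    exact hspan this (hLW.omega.isothermic_p.1.ne_zero θ t ht)
  · intro θ t ht h
    have := hs.m_p θ t ht
    rw [h, lip_zero_left] at this
    exact hΔ0 this.symm
  · exact fun θ t ht => hΛ.lip_eq_zero ht (hs.mem_m θ t ht) (hs.mem_m θ t ht)
  · intro θ t ht
    have hmem : σm θ t ∈ Λ θ t := by
      rw [hLW.omega.span_eq θ t ht]; exact Submodule.subset_span (by simp)
    have := hs.eq_of_mem hΔ0 hΛ hplane ht hmem
    rw [hLW.complex_m θ t ht, zero_div, zero_smul, zero_add] at this
    exact hspan this (hLW.omega.isothermic_m.1.ne_zero θ t ht)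
  · intro t ht
    have := (hμ t ht).1
    positivity
  · intro θ t ht
    obtain ⟨hμ0, -, -, -, hsq, -⟩ := hμ t ht
    obtain ⟨hr, -, hXY, -⟩ := profile_derivatives hΔ0 hI hΛ hplane hrot hframe hLW hs ht
    obtain ⟨⟨-, h1⟩, ⟨-, h2⟩⟩ := hs.pd_eq hI hΛ hplane hrot hframe θ ht
    obtain ⟨h3, h4⟩ := hs.pdθ_dual hΔ0 hI hΛ hplane hrot hframe hLW hC θ ht
    have h5 : lip (pdt sp θ t) (pdt sp θ t) = μ t ^ 2 * lip (sp 0 t) v ^ 2 := by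
      rw [h1, lip_parRot hframe.vv hframe.e₁e₁ hframe.ve₁, hsq, neg_sq]
    refine ⟨h3, by rw [h5]; positivity, by rw [mul_one]; exact h4, ?_⟩
    rw [h5, h1, h2, ← hC t ht]
    have h6 : pdt sm 0 t = (-(lip (sm 0 t) v / lip (sp 0 t) v)) • pdt sp 0 t := by
      refine smul_right_injective _ hr ?_
      change lip (sp 0 t) v • pdt sm 0 t =
        lip (sp 0 t) v • (-(lip (sm 0 t) v / lip (sp 0 t) v)) • pdt sp 0 t
      rw [smul_smul, mul_neg, mul_div_cancel₀ _ hr]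
      rw [neg_smul, eq_neg_iff_add_eq_zero, add_comm]
      exact hXY
    rw [h6, ← parRotCLM_apply, ← parRotCLM_apply, map_smul]
    congr 1
    field_simp

end Duality

/-- The image of a point of `P + ⟨v,o⟩` under a rotation `ρ₂`. -/
lemma IsParabolicFrame.parRot_add {p q v e₁ o e₂ : R42} (h : IsParabolicFrame p q v e₁ o e₂)
    {P : R42} (hP : P ∈ Submodule.span ℝ {p, q}) (ψ d r : ℝ) :
    parRot v e₂ ψ (P + d • v + r • o) =
      P + (d + r * ψ ^ 2 / 2) • v + r • o + (r * ψ) • e₂ := by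
  obtain ⟨k1, -, -, k4⟩ := h.lip_of_mem_span hP
  simp only [parRot, lip_add_left, lip_smul_left, k1, k4, h.vv, h.ve₂, h.oe₂, lip_comm o v, h.vo]
  module

/-! ### The parametrization of linear Weingarten surfaces of parabolic rotation -/

theorem mainTheorem9
    (p q : R42) (hpq : IsHyperbolicSpaceForm p q)
    (pp pm : R42) (hplane : Submodule.span ℝ {pp, pm} = Submodule.span ℝ {p, q})
    (v e₁ o e₂ : R42) (hframe : IsParabolicFrame p q v e₁ o e₂)
    (I : Set ℝ) (hIo : IsOpen I) (hIc : I.OrdConnected) (hIn : I.Nonempty)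
    (f n : ℝ → ℝ → R42) (Λ : ℝ → ℝ → Submodule ℝ R42)
    (hΛ : IsLegendreLift p q I f n Λ)
    (hrot : IsParabolicRotational v e₁ I Λ)
    (σp σm : ℝ → ℝ → R42) (hLW : IsLinearWeingarten I Λ pp pm σp σm)
    (κp κm ε Δ : ℝ) (hκp : κp = lip pp pp) (hκm : κm = lip pm pm) (hε : ε = lip pp pm)
    (hΔ : Δ = κp * κm - ε ^ 2) (hκm0 : κm ≠ 0) :
    (∃ sp sm : ℝ → ℝ → R42, IsNormalizedDualLift I pp pm Δ σp σm sp sm) ∧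
    ∀ sp sm : ℝ → ℝ → R42, IsNormalizedDualLift I pp pm Δ σp σm sp sm →
      ∃ C C₁ C₂ : ℝ, C ≠ 0 ∧
        (∀ θ, ∀ t ∈ I,
          pdθ sm θ t = (C / lip (pdθ sp θ t) (pdθ sp θ t)) • pdθ sp θ t) ∧
        (parPoly κp κm ε C).roots = {C₁, C₂} ∧
        ∃ (J : Set ℝ) (τ r ψ d : ℝ → ℝ),
          IsOpen J ∧ J.OrdConnected ∧
          ContDiffOn ℝ ∞ τ J ∧ BijOn τ J I ∧ (∀ t ∈ J, deriv τ t ≠ 0) ∧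
          ContDiffOn ℝ ∞ r J ∧ ContDiffOn ℝ ∞ ψ J ∧ ContDiffOn ℝ ∞ d J ∧
          (∀ θ, ∀ t ∈ J, sp θ (τ t) =
            parRot v e₁ θ (parRot v e₂ (ψ t)
              ((-ε) • pp + κp • pm + d t • v + r t • o))) ∧
          ∀ t ∈ J,
            r t ≠ 0 ∧
            deriv r t ^ 2 = κm / Δ ^ 2 * (r t ^ 2 - C₁) * (r t ^ 2 - C₂) ∧
            deriv ψ t = √(-(1 / Δ)) * ((ε * r t ^ 2 + κp * C) / r t ^ 2) ∧
            d t = κp * Δ / (2 * r t) := by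
  have hΔneg : Δ < 0 := by rw [hΔ, hκp, hκm, hε]; exact gram_det_neg hpq hplane
  constructor
  · obtain ⟨sp, sm, hs⟩ := hΛ.exists_adaptedPair hplane hκp hκm hε hΔ
    exact ⟨sp, sm, hs.isNormalizedDualLift hpq hIo hIc hIn hΛ hplane hrot hframe hLW
      hκp hκm hε hΔ⟩
  intro sp sm hdual
  have hs := hdual.isAdaptedPair hLW
  obtain ⟨C, hC0, hC⟩ :=
    exists_profile_constant hΔneg.ne hIo hIc hIn hΛ hplane hrot hframe hLW hs
  obtain ⟨hroots, hfactor⟩ := parPoly_roots (C := C) hΔ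
    (Real.sq_sqrt (by linarith : 0 ≤ -Δ)) hκm0
  obtain ⟨r, hr⟩ : ∃ r : ℝ → ℝ, r = fun t => -lip (sp 0 t) v := ⟨_, rfl⟩
  obtain ⟨ψ, hψ⟩ : ∃ ψ : ℝ → ℝ, ψ = fun t => lip (sp 0 t) e₂ / r t := ⟨_, rfl⟩
  obtain ⟨μ, ζ, sμ, hμ⟩ := exists_profile_speed hpq hIo hΛ hplane hrot hframe hLW hs
    hκp hκm hε hΔ hC hr hψ
  have hr0 : ∀ t ∈ I, r t ≠ 0 := fun t ht => by
    rw [hr]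
    exact neg_ne_zero.2 (profile_derivatives hΔneg.ne hIo hΛ hplane hrot hframe hLW hs ht).1
  have sr : ContDiffOn ℝ ∞ r I := hr ▸ (hs.smooth_p.profile.lip_const v).neg
  have sψ : ContDiffOn ℝ ∞ ψ I := hψ ▸ (hs.smooth_p.profile.lip_const e₂).div sr hr0
  obtain ⟨J, τ, hJo, hJc, sτ, hτ, dτ⟩ :=
    exists_reparametrization hIo hIc hIn sμ fun t ht => (hμ t ht).1
  have srτ : ContDiffOn ℝ ∞ (fun t => r (τ t)) J := sr.comp sτ hτ.mapsTo
  have hr0τ : ∀ t ∈ J, r (τ t) ≠ 0 := fun t ht => hr0 _ (hτ.mapsTo ht)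
  refine ⟨C, _, _, hC0, fun θ t ht =>
    (hs.pdθ_dual hΔneg.ne hIo hΛ hplane hrot hframe hLW hC θ ht).2, hroots,
    J, τ, fun t => r (τ t), fun t => ψ (τ t), fun t => κp * Δ / (2 * r (τ t)), hJo, hJc, sτ, hτ,
    ?_, srτ, sψ.comp sτ hτ.mapsTo, ?_, ?_, ?_⟩
  · intro t ht
    rw [(dτ t ht).deriv]
    exact inv_ne_zero (hμ _ (hτ.mapsTo ht)).1
  · exact contDiffOn_const.div (contDiffOn_const.mul srτ)
      fun t ht => mul_ne_zero two_ne_zero (hr0τ t ht)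
  · intro θ t ht
    have htI := hτ.mapsTo ht
    obtain ⟨-, -, -, -, -, hx, ha⟩ := hμ _ htI
    have hP : (-ε) • pp + κp • pm ∈ Submodule.span ℝ {p, q} :=
      hplane ▸ Submodule.mem_span_pair.2 ⟨_, _, rfl⟩
    rw [eq_parRot_profile hΛ hplane hrot hframe hs.mem_p htI (fun θ => hs.p_p θ _ htI)
      (fun θ => hs.p_m θ _ htI) θ, hframe.parRot_add hP, ← ha, ← hx]
  · intro t ht
    obtain ⟨hμ0, hζ, dr, dψ, -⟩ := hμ _ (hτ.mapsTo ht)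
    refine ⟨hr0τ t ht, ?_, ?_, rfl⟩
    · have h1 : deriv (fun t => r (τ t)) t = ζ (τ t) := by
        refine (dr.comp t (dτ t ht)).deriv.trans ?_
        field_simp
      rw [h1, hζ, hfactor]
      ring
    · have h1 : deriv (fun t => ψ (τ t)) t = _ := (dψ.comp t (dτ t ht)).deriv
      rw [h1]
      field_simp
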